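/- **Conventions.** $\mathrm{Cl}_m$ is the real Clifford algebra of $\mathbb{R}^m$ with $v\cdot v=-|v|^2$, $\mathbb{C}\mathrm{l}_m$ its complexification, $(E_1,\dots,E_m)$ the standard basis, and $\omega_m^{\mathbb C}=\epsilon_m E_1\cdots E_m$ the complex volume element, with $\epsilon_{4k}=\epsilon_{4k+3}=1$, $\epsilon_{4k+1}=-i$, $\epsilon_{4k+2}=i$, so that $(\omega_m^{\mathbb C})^2=1$. For $m$ even, $(\Sigma_m,\sigma)$ is the (up to isomorphism unique) irreducible complex representation of $\mathbb{C}\mathrm{l}_m$, graded as $\Sigma_m=\Sigma_m^+\oplus\Sigma_m^-$ by the eigenvalues $\pm1$ of $\omega_m^{\mathbb C}$. For $m$ odd, $\Sigma_m$ and $\Sigma_m^\#$ are the irreducible complex representations on which $\omega_m^{\mathbb C}$ acts as $+1$ and $-1$ respectively. All of these carry Hermitian scalar products for which vectors of $\mathbb{R}^m$ act skew-Hermitian. Given a spin structure, i.e. a principal $\mathrm{Spin}(m)$-bundle $P_{\mathrm{Spin}}(M,g,\mathcal O)\to M$ together with a $\mathrm{Spin}(m)\to\mathrm{SO}(m)$-equivariant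 two-sheeted covering of the bundle $P_{\mathrm{SO}}(M,g,\mathcal O)$ of positively oriented orthonormal frames, the spinor bundles are the associated bundles $\Sigma^{(\#)}(M,g,\mathcal O)=P_{\mathrm{Spin}}(M,g,\mathcal O)\times_\sigma\Sigma_m^{(\#)}$, with the induced Hermitian metric, Clifford multiplication by tangent vectors, connection coming from the Levi-Civita connection of $g$, and, for $m$ even, the induced grading $\Sigma=\Sigma^+\oplus\Sigma^-$. **Proposition.** Let $(M,g)$ be a Riemannian manifold of dimension $m\ge 1$ with an orientation $\mathcal O$, and let $P_{\mathrm{Spin}}(M,g,\mathcal O)\to P_{\mathrm{SO}}(M,g,\mathcal O)$ be a spin structure on $(M,g,\mathcal O)$. Then there is a spin structure $P_{\mathrm{Spin}}(M,g,-\mathcal O)\to P_{\mathrm{SO}}(M,g,-\mathcal O)$ on $(M,g,-\mathcal O)$ with the following properties. * If $m$ is even, there is a parallel, isometric, complex linear bundle isomorphism $\Psi:\Sigma(M,g,-\mathcal O)\to\Sigma(M,g,\mathcal O)$ over $\mathrm{id}_M$ that commutes with Clifford multiplication; it maps $\Sigma(M,g,-\mathcal O)^+$ onto $\Sigma(M,g,\mathcal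 O)^-$ and $\Sigma(M,g,-\mathcal O)^-$ onto $\Sigma(M,g,\mathcal O)^+$. * If $m$ is odd, there is a parallel, isometric, complex linear bundle isomorphism $\Psi:\Sigma(M,g,-\mathcal O)\to\Sigma^\#(M,g,\mathcal O)$ over $\mathrm{id}_M$ that commutes with Clifford multiplication, and likewise one $\Sigma^\#(M,g,-\mathcal O)\to\Sigma(M,g,\mathcal O)$. -/

import Mathlib

open scoped Manifold ContDiff TensorProduct

noncomputable section

namespace SpinOr

/-! ### The Clifford algebra of Euclidean space and the spin group -/

/-- The quadratic form `-|v|²` on `ℝ^m`, so that Clifford multiplication satisfies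
`v · v = -|v|²`. -/
def negForm (m : ℕ) : QuadraticForm ℝ (EuclideanSpace ℝ (Fin m)) :=
  -LinearMap.BilinMap.toQuadraticMap (innerₗ (EuclideanSpace ℝ (Fin m)))

/-- The real Clifford algebra of `ℝ^m` with the relations `v · v = -|v|²`. -/
abbrev Cl (m : ℕ) : Type := CliffordAlgebra (negForm m)

/-- The inclusion `ℝ^m → Cl m`. -/
abbrev vec {m : ℕ} (v : EuclideanSpace ℝ (Fin m)) : Cl m := CliffordAlgebra.ι (negForm m) v

/-- The standard basis vectors `E_i` of `ℝ^m`. -/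
abbrev E {m : ℕ} (i : Fin m) : EuclideanSpace ℝ (Fin m) := EuclideanSpace.single i (1 : ℝ)

/-- The usual topology of the finite dimensional real vector space `Cl m`. -/
instance (m : ℕ) : TopologicalSpace (CliffordAlgebra (negForm m)) :=
  moduleTopology ℝ (CliffordAlgebra (negForm m))

/-- `Spin(m)`, a subgroup of the units of `Cl m`; it carries the subspace topology. -/
abbrev Spin (m : ℕ) : Type := spinGroup (negForm m)

theorem negForm_apply {m : ℕ} (v : EuclideanSpace ℝ (Fin m)) :
    negForm m v = -(inner ℝ v v) := by
  simp [negForm]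

theorem vec_injective {m : ℕ} :
    Function.Injective (vec : EuclideanSpace ℝ (Fin m) → Cl m) := by
  have : Invertible (2 : ℝ) := invertibleOfNonzero two_ne_zero
  intro v w h
  have h2 := congrArg (CliffordAlgebra.equivExterior (negForm m)) h
  rw [vec, vec, CliffordAlgebra.equivExterior, CliffordAlgebra.changeFormEquiv_apply,
    CliffordAlgebra.changeFormEquiv_apply, CliffordAlgebra.changeForm_ι,
    CliffordAlgebra.changeForm_ι] at h2
  exact (ExteriorAlgebra.ι_inj ℝ v w).1 h2

theorem exists_spinAction {m : ℕ} (B : Spin m) (v : EuclideanSpace ℝ (Fin m)) :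
    ∃ w : EuclideanSpace ℝ (Fin m),
      vec w = (B : Cl m) * vec v * ((B⁻¹ : Spin m) : Cl m) := by
  have : Invertible (2 : ℝ) := invertibleOfNonzero two_ne_zero
  have h := spinGroup.conjAct_smul_ι_mem_range_ι (Q := negForm m) (x := spinGroup.toUnits B)
    B.2 v
  rw [ConjAct.units_smul_def] at h
  exact h

/-- The action of `B ∈ Spin(m)` on `ℝ^m` through the double covering `λ : Spin(m) → SO(m)`,
`λ(B) v = B · v · B⁻¹`. -/
def spinAction {m : ℕ} (B : Spin m) (v : EuclideanSpace ℝ (Fin m)) : EuclideanSpace ℝ (Fin m) :=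
  (exists_spinAction B v).choose

theorem vec_spinAction {m : ℕ} (B : Spin m) (v : EuclideanSpace ℝ (Fin m)) :
    vec (spinAction B v) = (B : Cl m) * vec v * ((B⁻¹ : Spin m) : Cl m) :=
  (exists_spinAction B v).choose_spec

/-- The matrix of `λ(B)`. -/
def spinMatrix {m : ℕ} (B : Spin m) : Matrix (Fin m) (Fin m) ℝ :=
  Matrix.of fun i j => spinAction B (E j) i

/-! ### Complex Clifford modules -/

/-- The factor `ε_m` of the complex volume element. -/
def volFactor (m : ℕ) : ℂ :=
  if m % 4 = 1 then -Complex.I else if m % 4 = 2 then Complex.I else 1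

/-- The complex volume element `ω = ε_m E_1 · E_2 ⋯ E_m` of the complexified Clifford algebra. -/
def complexVolume (m : ℕ) : ℂ ⊗[ℝ] Cl m :=
  volFactor m ⊗ₜ[ℝ] (List.ofFn fun i : Fin m => vec (E i)).prod

/-- An irreducible complex representation of the complexified Clifford algebra of `ℝ^m` on a
Hermitian vector space, such that vectors in `ℝ^m` act by skew-Hermitian endomorphisms (that is,
unit vectors act unitarily). -/
structure SpinorModule (m : ℕ) (S : Type*) [NormedAddCommGroup S] [InnerProductSpace ℂ S] where
  rep : (ℂ ⊗[ℝ] Cl m) →ₐ[ℂ] Module.End ℂ S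
  skew : ∀ (v : EuclideanSpace ℝ (Fin m)) (s t : S),
    inner ℂ (rep (1 ⊗ₜ[ℝ] vec v) s) t = -inner ℂ s (rep (1 ⊗ₜ[ℝ] vec v) t)
  nontrivial : Nontrivial S
  irreducible : ∀ W : Submodule ℂ S, (∀ a, ∀ s ∈ W, rep a s ∈ W) → W = ⊥ ∨ W = ⊤

namespace SpinorModule

variable {m : ℕ} {S : Type*} [NormedAddCommGroup S] [InnerProductSpace ℂ S]

/-- The action of the real Clifford algebra. -/
def act (σ : SpinorModule m S) (a : Cl m) : Module.End ℂ S := σ.rep (1 ⊗ₜ[ℝ] a)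

/-- The complex volume element acts as the identity. -/
def VolumeIsOne (σ : SpinorModule m S) : Prop := σ.rep (complexVolume m) = 1

/-- The complex volume element acts as minus the identity. -/
def VolumeIsNegOne (σ : SpinorModule m S) : Prop := σ.rep (complexVolume m) = -1

theorem act_one (σ : SpinorModule m S) : σ.act 1 = 1 := by
  rw [act, ← Algebra.TensorProduct.one_def, map_one]

theorem act_mul (σ : SpinorModule m S) (a b : Cl m) : σ.act (a * b) = σ.act a * σ.act b := by
  rw [act, act, act, ← map_mul, Algebra.TensorProduct.tmul_mul_tmul, one_mul]

theorem act_add (σ : SpinorModule m S) (a b : Cl m) : σ.act (a + b) = σ.act a + σ.act b := by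
  rw [act, act, act, ← map_add, TensorProduct.tmul_add]

theorem act_neg (σ : SpinorModule m S) (a : Cl m) : σ.act (-a) = -σ.act a := by
  rw [act, act, ← map_neg, TensorProduct.tmul_neg]

theorem inner_act (σ : SpinorModule m S) (a : Cl m) (s t : S) :
    inner ℂ (σ.act a s) t = inner ℂ s (σ.act (star a) t) := by
  induction a using CliffordAlgebra.induction generalizing s t with
  | algebraMap r =>
    have h : σ.act (algebraMap ℝ (Cl m) r) = (r : ℂ) • (1 : Module.End ℂ S) := by
      rw [act, Algebra.algebraMap_eq_smul_one, TensorProduct.tmul_smul,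
        ← Algebra.TensorProduct.one_def]
      have : (r • (1 : ℂ ⊗[ℝ] Cl m)) = (r : ℂ) • (1 : ℂ ⊗[ℝ] Cl m) := by
        rw [Algebra.TensorProduct.one_def, TensorProduct.smul_tmul', TensorProduct.smul_tmul']
        simp
      rw [this, map_smul, map_one]
    rw [CliffordAlgebra.star_algebraMap, h]
    simp
  | ι v =>
    rw [CliffordAlgebra.star_ι, act_neg, LinearMap.neg_apply, inner_neg_right]
    exact σ.skew v s t
  | mul a b ha hb =>
    rw [star_mul, act_mul, act_mul, Module.End.mul_apply, Module.End.mul_apply, ha, hb]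
  | add a b ha hb =>
    rw [star_add, act_add, act_add, LinearMap.add_apply, LinearMap.add_apply, inner_add_left,
      inner_add_right, ha, hb]

theorem norm_act_spin (σ : SpinorModule m S) (B : Spin m) (s : S) :
    ‖σ.act (B : Cl m) s‖ = ‖s‖ := by
  have h : inner ℂ (σ.act (B : Cl m) s) (σ.act (B : Cl m) s) = inner ℂ s s := by
    rw [inner_act, ← Module.End.mul_apply, ← act_mul, spinGroup.coe_star_mul_self, act_one,
      Module.End.one_apply]
  rw [inner_self_eq_norm_sq_to_K, inner_self_eq_norm_sq_to_K] at h
  have h2 : ‖σ.act (B : Cl m) s‖ ^ 2 = ‖s‖ ^ 2 := by exact_mod_cast h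
  exact (sq_eq_sq₀ (norm_nonneg _) (norm_nonneg _)).1 h2

end SpinorModule

/-! ### Riemannian metrics, orientations, and oriented orthonormal frames -/

section Manifold

variable {m : ℕ} {M : Type*} [TopologicalSpace M] [ChartedSpace (EuclideanSpace ℝ (Fin m)) M]
  [IsManifold (𝓡 m) ∞ M]

variable (m M) in
/-- Smooth Riemannian metrics on the `m`-dimensional manifold `M`. -/
abbrev Metric : Type _ :=
  Bundle.ContMDiffRiemannianMetric (𝓡 m) ∞ (EuclideanSpace ℝ (Fin m))
    (fun x : M => TangentSpace (𝓡 m) x)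

/-- The vector field `V` is smooth on the set `U`. -/
def SmoothFieldOn (V : ∀ x : M, TangentSpace (𝓡 m) x) (U : Set M) : Prop :=
  ContMDiffOn (𝓡 m) (𝓡 m).tangent ∞ (fun x => (⟨x, V x⟩ : TangentBundle (𝓡 m) M)) U

variable (m M) in
/-- An orientation of `M`: an orientation of each tangent space, depending continuously on the
base point. Continuity means that near each point there is a smooth frame which is everywhere
positively oriented or everywhere negatively oriented. -/
structure ManifoldOrientation where
  orient : ∀ x : M, Orientation ℝ (TangentSpace (𝓡 m) x) (Fin m)
  continuous : ∀ x₀ : M, ∃ U : Set M, IsOpen U ∧ x₀ ∈ U ∧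
    ∃ b : ∀ x : M, Module.Basis (Fin m) ℝ (TangentSpace (𝓡 m) x),
      (∀ i, SmoothFieldOn (fun x => b x i) U) ∧
      ((∀ x ∈ U, (b x).orientation = orient x) ∨ (∀ x ∈ U, (b x).orientation = -orient x))

/-- The opposite orientation `-O`. -/
instance : Neg (ManifoldOrientation m M) where
  neg O :=
    { orient := fun x => -O.orient x
      continuous := fun x₀ => by
        obtain ⟨U, hU, hx, b, hb, h⟩ := O.continuous x₀
        exact ⟨U, hU, hx, b, hb, h.symm.imp id
          fun h y hy => (h y hy).trans (neg_neg (O.orient y)).symm⟩ }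

/-- A `g`-orthonormal basis of `T_x M` that is positively oriented with respect to `O`. -/
structure OrientedFrame (g : Metric m M) (O : ManifoldOrientation m M) (x : M) where
  basis : Module.Basis (Fin m) ℝ (TangentSpace (𝓡 m) x)
  orthonormal : ∀ i j, g.inner x (basis i) (basis j) = if i = j then 1 else 0
  oriented : basis.orientation = O.orient x

/-- The total space of the bundle `P_SO(M,g,O)` of positively oriented orthonormal frames. -/
structure FrameBundle (g : Metric m M) (O : ManifoldOrientation m M) where
  base : M
  frame : OrientedFrame g O base

/-- The topology of `P_SO(M,g,O)`, as a subspace of `M × (TM)^m`. -/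
instance (g : Metric m M) (O : ManifoldOrientation m M) : TopologicalSpace (FrameBundle g O) :=
  TopologicalSpace.induced
    (fun f => ((f.base, fun i => ⟨f.base, f.frame.basis i⟩) : M × (Fin m → TangentBundle (𝓡 m) M)))
    inferInstance

/-- `f' = f · A` for frames `f, f'` and a matrix `A`: the frames have the same base point and
`f'_j = ∑ i, A i j • f_i`. -/
def FrameBundle.IsTranslate {g : Metric m M} {O : ManifoldOrientation m M}
    (f : FrameBundle g O) (A : Matrix (Fin m) (Fin m) ℝ) (f' : FrameBundle g O) : Prop :=
  f'.base = f.base ∧ ∀ j, (⟨f'.base, f'.frame.basis j⟩ : TangentBundle (𝓡 m) M) =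
    ⟨f.base, ∑ i, A i j • f.frame.basis i⟩

theorem FrameBundle.IsTranslate.basis_eq {g : Metric m M} {O : ManifoldOrientation m M}
    {f f' : FrameBundle g O} {A : Matrix (Fin m) (Fin m) ℝ} (h : f.IsTranslate A f') {x : M}
    (hf : f.base = x) (hf' : f'.base = x) (j : Fin m) :
    (hf' ▸ f'.frame : OrientedFrame g O x).basis j =
      ∑ i, A i j • (hf ▸ f.frame : OrientedFrame g O x).basis i := by
  obtain ⟨y, F⟩ := f
  obtain ⟨y', F'⟩ := f'
  dsimp only at hf hf'
  subst hf hf'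
  have h2 := h.2 j
  rw [Bundle.TotalSpace.mk.injEq] at h2
  exact eq_of_heq h2.2

/-! ### Spin structures -/

/-- A spin structure on `(M,g,O)`: a principal `Spin(m)`-bundle `P_Spin(M,g,O) → M` together with a
two-sheeted covering `P_Spin(M,g,O) → P_SO(M,g,O)` over `M` that is equivariant with respect to
`λ : Spin(m) → SO(m)`. As the latter map is a covering, the smooth structure of `P_Spin(M,g,O)` is
the one pulled back from `P_SO(M,g,O)`, and it needs no separate mention. -/
structure SpinStructure (g : Metric m M) (O : ManifoldOrientation m M) where
  /-- the total space -/
  P : Type*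
  [topology : TopologicalSpace P]
  /-- the covering map onto the frame bundle -/
  cover : P → FrameBundle g O
  /-- the right action of the spin group -/
  act : P → Spin m → P
  act_one : ∀ p, act p 1 = p
  act_mul : ∀ p B C, act p (B * C) = act (act p B) C
  continuous_act : Continuous fun q : P × Spin m => act q.1 q.2
  isCoveringMap : IsCoveringMap cover
  two_sheeted : ∀ f, (cover ⁻¹' {f}).ncard = 2
  equivariant : ∀ p B, (cover p).IsTranslate (spinMatrix B) (cover (act p B))
  locallyTrivial : ∀ x₀ : M, ∃ U : Set M, IsOpen U ∧ x₀ ∈ U ∧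
    ∃ h : {p : P // (cover p).base ∈ U} ≃ₜ U × Spin m,
      (∀ p, ((h p).1 : M) = (cover p.1).base) ∧
      ∀ (p p' : {p : P // (cover p).base ∈ U}) (B : Spin m),
        p'.1 = act p.1 B → (h p').2 = (h p).2 * B

attribute [instance] SpinStructure.topology

namespace SpinStructure

variable {g : Metric m M} {O : ManifoldOrientation m M} (P : SpinStructure g O)

/-- The fibre of `P_Spin(M,g,O)` over `x`. -/
def FiberAt (x : M) : Type _ := {p : P.P // (P.cover p).base = x}

variable {P}

/-- The oriented orthonormal frame below a point of `P_Spin(M,g,O)` over `x`. -/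
def FiberAt.frame {x : M} (p : P.FiberAt x) : OrientedFrame g O x :=
  p.2 ▸ (P.cover p.1).frame

/-- The right action of `Spin(m)` on the fibres. -/
def FiberAt.act {x : M} (p : P.FiberAt x) (B : Spin m) : P.FiberAt x :=
  ⟨P.act p.1 B, (P.equivariant p.1 B).1.trans p.2⟩

theorem FiberAt.act_one {x : M} (p : P.FiberAt x) : p.act 1 = p :=
  Subtype.ext (P.act_one p.1)

theorem FiberAt.act_mul {x : M} (p : P.FiberAt x) (B C : Spin m) :
    p.act (B * C) = (p.act B).act C :=
  Subtype.ext (P.act_mul p.1 B C)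

theorem FiberAt.nonempty (P : SpinStructure g O) (x : M) : Nonempty (P.FiberAt x) := by
  obtain ⟨U, -, hx, h, h1, -⟩ := P.locallyTrivial x
  refine ⟨⟨(h.symm (⟨x, hx⟩, 1)).1, ?_⟩⟩
  rw [← h1, Homeomorph.apply_symm_apply]

/-- `Spin(m)` acts freely on the fibres. -/
theorem FiberAt.act_free {x : M} (p : P.FiberAt x) {B : Spin m} (hB : p.act B = p) : B = 1 := by
  obtain ⟨U, -, hx, h, h1, h2⟩ := P.locallyTrivial x
  have hp : (P.cover p.1).base ∈ U := by rw [p.2]; exact hx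
  have := h2 ⟨p.1, hp⟩ ⟨p.1, hp⟩ B (congrArg Subtype.val hB).symm
  simpa using this

/-- `Spin(m)` acts transitively on the fibres. -/
theorem FiberAt.act_transitive {x : M} (p q : P.FiberAt x) : ∃ B : Spin m, q = p.act B := by
  obtain ⟨U, -, hx, h, h1, h2⟩ := P.locallyTrivial x
  have hp : (P.cover p.1).base ∈ U := by rw [p.2]; exact hx
  have hq : (P.cover q.1).base ∈ U := by rw [q.2]; exact hx
  let B : Spin m := ((h ⟨p.1, hp⟩).2)⁻¹ * (h ⟨q.1, hq⟩).2
  have hpB : (P.cover (P.act p.1 B)).base ∈ U := by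
    rw [(P.equivariant p.1 B).1]; exact hp
  have e2 : (h ⟨P.act p.1 B, hpB⟩).2 = (h ⟨q.1, hq⟩).2 := by
    rw [h2 ⟨p.1, hp⟩ ⟨P.act p.1 B, hpB⟩ B rfl, mul_inv_cancel_left]
  have e1 : (h ⟨P.act p.1 B, hpB⟩).1 = (h ⟨q.1, hq⟩).1 := by
    apply Subtype.ext
    rw [h1, h1]
    exact ((P.equivariant p.1 B).1.trans p.2).trans q.2.symm
  have e3 := h.injective (Prod.ext e1 e2)
  exact ⟨B, Subtype.ext (congrArg Subtype.val e3).symm⟩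

/-- The frame below `p · B` is `f · λ(B)`, with `f` the frame below `p`. -/
theorem FiberAt.frame_act {x : M} (p : P.FiberAt x) (B : Spin m) (j : Fin m) :
    (p.act B).frame.basis j = ∑ i, spinMatrix B i j • p.frame.basis i :=
  (P.equivariant p.1 B).basis_eq p.2 (p.act B).2 j

/-! ### Spinor bundles -/

variable {S : Type*} [NormedAddCommGroup S] [InnerProductSpace ℂ S]

/-- The equivalence relation `(p, s) ∼ (p · B, σ(B⁻¹) s)` on `P_Spin(M,g,O)_x × Σ_m`. -/
def spinorSetoid (P : SpinStructure g O) (σ : SpinorModule m S) (x : M) :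
    Setoid (P.FiberAt x × S) where
  r a b := ∃ B : Spin m, b = (a.1.act B, σ.act ((B⁻¹ : Spin m) : Cl m) a.2)
  iseqv :=
    { refl := fun a => ⟨1, by
        rw [inv_one, Submonoid.coe_one, SpinorModule.act_one, FiberAt.act_one]; rfl⟩
      symm := by
        rintro a _ ⟨B, rfl⟩
        refine ⟨B⁻¹, ?_⟩
        rw [← FiberAt.act_mul, mul_inv_cancel, FiberAt.act_one, inv_inv, ← Module.End.mul_apply,
          ← SpinorModule.act_mul, ← Submonoid.coe_mul, mul_inv_cancel, Submonoid.coe_one,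
          SpinorModule.act_one]
        rfl
      trans := by
        rintro a _ _ ⟨B, rfl⟩ ⟨C, rfl⟩
        refine ⟨B * C, ?_⟩
        rw [FiberAt.act_mul, mul_inv_rev, Submonoid.coe_mul, SpinorModule.act_mul]
        rfl }

/-- The fibre over `x` of the spinor bundle `P_Spin(M,g,O) ×_σ Σ_m` associated to the Clifford
module `(Σ_m, σ)`. -/
def Spinor (P : SpinStructure g O) (σ : SpinorModule m S) (x : M) : Type _ :=
  Quotient (P.spinorSetoid σ x)

namespace Spinor

variable {σ : SpinorModule m S} {x : M}

/-- The class `[p, s]` of a pair `(p, s)`. -/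
def mk (σ : SpinorModule m S) (p : P.FiberAt x) (s : S) : P.Spinor σ x :=
  Quotient.mk (P.spinorSetoid σ x) (p, s)

theorem mk_act (σ : SpinorModule m S) (p : P.FiberAt x) (B : Spin m) (s : S) :
    mk σ (p.act B) s = mk σ p (σ.act (B : Cl m) s) := by
  refine (Quotient.sound ⟨B, ?_⟩ : mk σ p (σ.act (B : Cl m) s) = mk σ (p.act B) s).symm
  rw [← Module.End.mul_apply, ← SpinorModule.act_mul, ← Submonoid.coe_mul, inv_mul_cancel,
    Submonoid.coe_one, SpinorModule.act_one]
  rfl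

theorem mk_bijective (σ : SpinorModule m S) (p : P.FiberAt x) :
    Function.Bijective (mk σ p : S → P.Spinor σ x) := by
  constructor
  · intro s t h
    obtain ⟨B, hB⟩ := Quotient.exact h
    have h1 := p.act_free (congrArg Prod.fst hB).symm
    subst h1
    have h2 := congrArg Prod.snd hB
    rw [inv_one, Submonoid.coe_one, SpinorModule.act_one] at h2
    exact h2.symm
  · intro ψ
    induction ψ using Quotient.inductionOn with
    | h a =>
      obtain ⟨q, s⟩ := a
      obtain ⟨B, rfl⟩ := p.act_transitive q
      exact ⟨σ.act (B : Cl m) s, (mk_act σ p B s).symm⟩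

/-- The bijection `[p, s] ↦ s` from the fibre over `x` to the Clifford module, for a fixed `p`. -/
def coordEquiv (σ : SpinorModule m S) (p : P.FiberAt x) : P.Spinor σ x ≃ S :=
  (Equiv.ofBijective _ (mk_bijective σ p)).symm

theorem coordEquiv_mk (p : P.FiberAt x) (s : S) : coordEquiv σ p (mk σ p s) = s :=
  Equiv.ofBijective_symm_apply_apply _ _ _

theorem mk_coordEquiv (p : P.FiberAt x) (ψ : P.Spinor σ x) : mk σ p (coordEquiv σ p ψ) = ψ :=
  Equiv.ofBijective_apply_symm_apply _ _ _

theorem coordEquiv_act (p : P.FiberAt x) (B : Spin m) (ψ : P.Spinor σ x) :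
    coordEquiv σ p ψ = σ.act (B : Cl m) (coordEquiv σ (p.act B) ψ) := by
  conv_lhs => rw [← mk_coordEquiv (p.act B) ψ, mk_act, coordEquiv_mk]

/-- An auxiliary point of the fibre of `P_Spin(M,g,O)` over `x`, used to write down the Hermitian
vector space structure of the fibres of the spinor bundle; that structure does not depend on it,
see `coord`. -/
def basePoint (P : SpinStructure g O) (x : M) : P.FiberAt x :=
  Classical.choice (FiberAt.nonempty P x)

instance : AddCommGroup (P.Spinor σ x) := (coordEquiv σ (basePoint P x)).addCommGroup

instance : Module ℂ (P.Spinor σ x) := (coordEquiv σ (basePoint P x)).module ℂ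

/-- `coordEquiv` at the auxiliary point, as a linear equivalence. -/
def coordBase (σ : SpinorModule m S) (x : M) : P.Spinor σ x ≃ₗ[ℂ] S :=
  (coordEquiv σ (basePoint P x)).linearEquiv ℂ

instance : NormedAddCommGroup (P.Spinor σ x) :=
  NormedAddCommGroup.induced (P.Spinor σ x) S (coordBase σ x) (coordBase σ x).injective

instance : InnerProductSpace ℂ (P.Spinor σ x) where
  norm_smul_le c ψ := by
    change ‖coordBase σ x (c • ψ)‖ ≤ ‖c‖ * ‖coordBase σ x ψ‖
    rw [map_smul, norm_smul]
  inner ψ χ := inner ℂ (coordBase σ x ψ) (coordBase σ x χ)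
  norm_sq_eq_re_inner ψ := norm_sq_eq_re_inner (𝕜 := ℂ) (coordBase σ x ψ)
  conj_inner_symm ψ χ := inner_conj_symm (coordBase σ x ψ) (coordBase σ x χ)
  add_left ψ χ η := by rw [map_add, inner_add_left]
  smul_left ψ χ c := by rw [map_smul, inner_smul_left]

theorem coordEquiv_eq (σ : SpinorModule m S) (p : P.FiberAt x) :
    ∃ B : Spin m, ∀ ψ, coordEquiv σ p ψ = σ.act (B : Cl m) (coordBase σ x ψ) := by
  obtain ⟨B, hB⟩ := p.act_transitive (basePoint P x)
  refine ⟨B, fun ψ => ?_⟩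
  rw [coordEquiv_act p B, ← hB]
  rfl

/-- For each `p` over `x`, the map `[p, s] ↦ s` is a complex linear isometry. This characterizes
the Hermitian vector space structure of the fibres of the spinor bundle. -/
def coord (σ : SpinorModule m S) (p : P.FiberAt x) : P.Spinor σ x ≃ₗᵢ[ℂ] S :=
  { toLinearEquiv :=
      { coordEquiv σ p with
        map_add' := fun ψ χ => by
          obtain ⟨B, hB⟩ := coordEquiv_eq σ p
          change coordEquiv σ p (ψ + χ) = coordEquiv σ p ψ + coordEquiv σ p χ
          rw [hB, hB, hB, map_add, map_add]
        map_smul' := fun c ψ => by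
          obtain ⟨B, hB⟩ := coordEquiv_eq σ p
          change coordEquiv σ p (c • ψ) = c • coordEquiv σ p ψ
          rw [hB, hB, map_smul, map_smul] }
    norm_map' := fun ψ => by
      obtain ⟨B, hB⟩ := coordEquiv_eq σ p
      change ‖coordEquiv σ p ψ‖ = ‖coordBase σ x ψ‖
      rw [hB, SpinorModule.norm_act_spin] }

theorem coord_apply (p : P.FiberAt x) (ψ : P.Spinor σ x) : coord σ p ψ = coordEquiv σ p ψ := rfl

theorem coord_mk (p : P.FiberAt x) (s : S) : coord σ p (mk σ p s) = s := coordEquiv_mk p s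

theorem mk_coord (p : P.FiberAt x) (ψ : P.Spinor σ x) : mk σ p (coord σ p ψ) = ψ :=
  mk_coordEquiv p ψ

end Spinor

/-! ### Clifford multiplication and the grading -/

/-- The vector `v ∈ ℝ^m` with `X = ∑ i, v_i • e_i`, where `(e_i)` is the frame below `p`. In other
words `X = [p, v]`, viewing `TM` as the bundle associated to `P_Spin(M,g,O)`. -/
def FiberAt.components {x : M} (p : P.FiberAt x) (X : TangentSpace (𝓡 m) x) :
    EuclideanSpace ℝ (Fin m) :=
  WithLp.toLp 2 fun i => p.frame.basis.repr X i

theorem FiberAt.vec_components_act {x : M} (p : P.FiberAt x) (B : Spin m)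
    (X : TangentSpace (𝓡 m) x) :
    vec (p.components X) =
      (B : Cl m) * vec ((p.act B).components X) * ((B⁻¹ : Spin m) : Cl m) := by
  set v := (p.act B).components X with hv
  have h1 : p.components X = ∑ j, v j • spinAction B (E j) := by
    ext i
    have hX : X = ∑ j, v j • (p.act B).frame.basis j := ((p.act B).frame.basis.sum_repr X).symm
    change p.frame.basis.repr X i = _
    rw [hX]
    simp only [frame_act, map_sum, map_smul, Finsupp.coe_finsetSum, Finsupp.coe_smul,
      Finset.sum_apply, Pi.smul_apply, smul_eq_mul, Module.Basis.repr_self, Finsupp.single_apply,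
      mul_ite, mul_one, mul_zero, Finset.sum_ite_eq', Finset.mem_univ, if_true, WithLp.ofLp_sum,
      WithLp.ofLp_smul]
    rfl
  have h2 : v = ∑ j, v j • E j := by
    ext i
    simp [Finset.sum_apply, Pi.single_apply]
  rw [h1]
  conv_rhs => rw [h2]
  simp only [vec, map_sum, map_smul, Finset.mul_sum, Finset.sum_mul, mul_smul_comm, smul_mul_assoc]
  exact Finset.sum_congr rfl fun j _ => congrArg _ (vec_spinAction B (E j))

namespace Spinor

variable {σ : SpinorModule m S} {x : M}

/-- Clifford multiplication `T_x M × Σ_x → Σ_x`, `[p, v] · [p, s] = [p, σ(v) s]`. -/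
def cliffordMul (X : TangentSpace (𝓡 m) x) (ψ : P.Spinor σ x) : P.Spinor σ x :=
  Quotient.lift (s := P.spinorSetoid σ x)
    (fun a => mk σ a.1 (σ.act (vec (a.1.components X)) a.2))
    (by
      rintro ⟨p, s⟩ _ ⟨B, rfl⟩
      dsimp only
      rw [mk_act, p.vec_components_act B X, SpinorModule.act_mul, SpinorModule.act_mul]
      rfl)
    ψ

/-- The subbundle `Σ^±`, for the sign `ε = ±1`: the classes `[p, s]` with `s` in the
`ε`-eigenspace of the complex volume element. -/
def half (P : SpinStructure g O) (σ : SpinorModule m S) (ε : ℤˣ) (x : M) : Set (P.Spinor σ x) :=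
  {ψ | ∃ (p : P.FiberAt x) (s : S), σ.rep (complexVolume m) s = ((ε : ℤ) : ℂ) • s ∧ ψ = mk σ p s}

end Spinor

/-! ### Smooth sections and the spinorial Levi-Civita connection -/

/-- The directional derivative `df(X)` at `x` of a function with values in a normed space. -/
def dirDeriv {F : Type*} [NormedAddCommGroup F] [NormedSpace ℝ F] (f : M → F) (x : M)
    (X : TangentSpace (𝓡 m) x) : F :=
  mfderiv (𝓡 m) 𝓘(ℝ, F) f x X

/-- The Koszul expression, `g(∇_X Y, Z)` at `x` for the Levi-Civita connection `∇` of `g`. -/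
def koszul (g : Metric m M) (X Y Z : ∀ y : M, TangentSpace (𝓡 m) y) (x : M) : ℝ :=
  (1 / 2 : ℝ) *
    (dirDeriv (fun y => g.inner y (Y y) (Z y)) x (X x)
      + dirDeriv (fun y => g.inner y (Z y) (X y)) x (Y x)
      - dirDeriv (fun y => g.inner y (X y) (Y y)) x (Z x)
      + g.inner x (VectorField.mlieBracket (𝓡 m) X Y x) (Z x)
      - g.inner x (VectorField.mlieBracket (𝓡 m) Y Z x) (X x)
      + g.inner x (VectorField.mlieBracket (𝓡 m) Z X x) (Y x))

/-- The Levi-Civita connection `1`-form of a local orthonormal frame `(e_i)`, that is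
`ω_ij(X) = g(∇_X e_i, e_j)`, for a tangent vector `X` at `x`. -/
def connectionForm (e : ∀ y : M, OrientedFrame g O y) (x : M) (X : TangentSpace (𝓡 m) x)
    (i j : Fin m) : ℝ :=
  ∑ k, (e x).basis.repr X k *
    koszul g (fun y => (e y).basis k) (fun y => (e y).basis i) (fun y => (e y).basis j) x

/-- `s` is a smooth local section of `P_Spin(M,g,O)` over the open set `U` (its values outside `U`
are irrelevant): it is continuous, and the section of `P_SO(M,g,O)` below it is smooth. -/
def IsSpinFrameOn (s : ∀ y : M, P.FiberAt y) (U : Set M) : Prop :=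
  IsOpen U ∧ ContinuousOn (fun y => (s y).1) U ∧
    ∀ i, SmoothFieldOn (fun y => (s y).frame.basis i) U

variable {σ : SpinorModule m S}

/-- A section `ψ` of the spinor bundle is smooth near `x`: there is a smooth local section `s` of
`P_Spin(M,g,O)` around `x` with `ψ = [s, φ]` for a smooth function `φ`. -/
def SmoothNear (ψ : ∀ y : M, P.Spinor σ y) (x : M) : Prop :=
  ∃ (s : ∀ y : M, P.FiberAt y) (U : Set M), x ∈ U ∧ IsSpinFrameOn s U ∧
    ContMDiffOn (𝓡 m) 𝓘(ℝ, S) ∞ (fun y => Spinor.coord σ (s y) (ψ y)) U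

/-- `ψ` is differentiable at `x` and `∇_X ψ = η`, for the Levi-Civita connection `∇` on the spinor
bundle. For `ψ = [s, φ]` around `x`, with a smooth local section `s` of `P_Spin(M,g,O)` above the
orthonormal frame `(e_i)`, one has
`∇_X ψ = [s, dφ(X) + (1/4) ∑ i j, g(∇_X e_i, e_j) σ(E_i · E_j) φ]`, independently of `s`. -/
def HasCovDerivAt (ψ : ∀ y : M, P.Spinor σ y) (x : M) (X : TangentSpace (𝓡 m) x)
    (η : P.Spinor σ x) : Prop :=
  ∃ (s : ∀ y : M, P.FiberAt y) (U : Set M), x ∈ U ∧ IsSpinFrameOn s U ∧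
    MDifferentiableAt (𝓡 m) 𝓘(ℝ, S) (fun y => Spinor.coord σ (s y) (ψ y)) x ∧
    η = Spinor.mk σ (s x)
      (dirDeriv (fun y => Spinor.coord σ (s y) (ψ y)) x X +
        (1 / 4 : ℝ) • ∑ i, ∑ j, connectionForm (fun y => (s y).frame) x X i j •
          σ.act (vec (E i) * vec (E j)) (Spinor.coord σ (s x) (ψ x)))

/-! ### Bundle isomorphisms -/

/-- A parallel, isometric, complex linear isomorphism of smooth vector bundles over `id_M` between
two spinor bundles (for possibly different orientations and Clifford modules) that commutes with
Clifford multiplication. -/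
structure SpinorIso {O' : ManifoldOrientation m M} (P' : SpinStructure g O')
    {S' : Type*} [NormedAddCommGroup S'] [InnerProductSpace ℂ S'] (σ' : SpinorModule m S')
    (P : SpinStructure g O)
    {S : Type*} [NormedAddCommGroup S] [InnerProductSpace ℂ S] (σ : SpinorModule m S) where
  /-- the complex linear isometric isomorphisms between the fibres -/
  map : ∀ x : M, P'.Spinor σ' x ≃ₗᵢ[ℂ] P.Spinor σ x
  smooth : ∀ (ψ : ∀ x, P'.Spinor σ' x) (x : M),
    SmoothNear ψ x ↔ SmoothNear (fun y => map y (ψ y)) x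
  parallel : ∀ (ψ : ∀ x, P'.Spinor σ' x) (x : M) (X : TangentSpace (𝓡 m) x)
    (η : P'.Spinor σ' x),
    HasCovDerivAt ψ x X η ↔ HasCovDerivAt (fun y => map y (ψ y)) x X (map x η)
  clifford : ∀ (x : M) (X : TangentSpace (𝓡 m) x) (ψ : P'.Spinor σ' x),
    map x (Spinor.cliffordMul X ψ) = Spinor.cliffordMul X (map x ψ)

end SpinStructure
end Manifold
end SpinOr

end

open SpinOr SpinStructure

universe u v w w'

noncomputable section

namespace SpinOr

/-! ### The reflection in a standard basis vector -/

section Reflection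

variable {m : ℕ} (i₀ : Fin m)

/-! Fix an index `i₀` (possible since `m ≥ 1`) and let `r` be the reflection of `ℝ^m` in `E_{i₀}`.
Negating the frame vector of index `i₀` identifies the frame bundles of `O` and `-O`, and
intertwines right multiplication by `A` with that by `r A r`. On the spin level, `r` induces an
automorphism of the Clifford algebra which preserves `Spin(m)` (`reflectCl_mem_spinGroup`) and
covers `A ↦ r A r` (`spinMatrix_reflectSpin`). So the old total space, with reflected covering map
and twisted action, is a spin structure for `-O`; it is chosen before any Clifford module.

For a linear isometry `T`, the assignment `[p, s] ↦ [p, T s]` is well defined and compatible with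
Clifford multiplication as soon as `T σ'(a) = σ(r a) T` (`ReflectIntertwines`; see `coord_flipMap`,
`flipMap_cliffordMul`). It is parallel because reflecting a frame multiplies `ω_ij` by `r_i r_j`,
while `r` maps `E_i E_j` to `r_i r_j E_i E_j`, so the signs cancel (`hasCovDerivAt_flipMap`).
Finally `r` negates the volume element, which exchanges the two halves for `m` even and `Σ` with
`Σ^#` for `m` odd.

It remains to find `T`. For `m` even it is the action of `ω E_{i₀}`. For `m` odd no classification
of modules is needed: averaging a nonzero linear map over the generators gives either a true
intertwiner or one up to `r` (`exists_intertwines_or`). The first is impossible because `ω` acts by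
opposite scalars, and Schur's lemma makes the second an isometry. -/

/-- The signs `r_i` with `r_{i₀} = -1` and `r_i = 1` otherwise. -/
def flipSign : Fin m → ℝˣ := Function.update 1 i₀ (-1)

theorem flipSign_eq_or (i : Fin m) :
    ((flipSign i₀ i : ℝˣ) : ℝ) = 1 ∨ ((flipSign i₀ i : ℝˣ) : ℝ) = -1 := by
  by_cases h : i = i₀ <;> simp [flipSign, h]

theorem flipSign_mul_self (i : Fin m) :
    ((flipSign i₀ i : ℝˣ) : ℝ) * ((flipSign i₀ i : ℝˣ) : ℝ) = 1 := by
  rcases flipSign_eq_or i₀ i with h | h <;> simp [h]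

theorem flipSign_mul_cancel (i : Fin m) (a : ℝ) :
    ((flipSign i₀ i : ℝˣ) : ℝ) * (((flipSign i₀ i : ℝˣ) : ℝ) * a) = a := by
  rw [← mul_assoc, flipSign_mul_self, one_mul]

theorem flipSign_inv (i : Fin m) : (flipSign i₀ i)⁻¹ = flipSign i₀ i :=
  inv_eq_of_mul_eq_one_left (Units.ext (flipSign_mul_self i₀ i))

theorem prod_flipSign : ∏ i, ((flipSign i₀ i : ℝˣ) : ℝ) = -1 := by
  have h : ∏ i, flipSign i₀ i = -1 := by
    rw [flipSign, Finset.prod_update_of_mem (Finset.mem_univ _)]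
    simp
  simpa using congrArg (Units.val) h

/-- The reflection of `ℝ^m` that changes the sign of the coordinate `i₀`, as an isometry of
quadratic forms. -/
def reflect : negForm m →qᵢ negForm m where
  toFun v := WithLp.toLp 2 fun i => (flipSign i₀ i : ℝ) * v i
  map_add' v w := by ext i; simp [mul_add]
  map_smul' c v := by ext i; simp [mul_left_comm]
  map_app' v := by
    change negForm m (WithLp.toLp 2 fun i => (flipSign i₀ i : ℝ) * v i) = negForm m v
    rw [negForm_apply, negForm_apply, PiLp.inner_apply, PiLp.inner_apply]
    congr 1
    refine Finset.sum_congr rfl fun i _ => ?_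
    change (_ * v i) * (_ * v i) = v i * v i
    rw [mul_mul_mul_comm, flipSign_mul_self, one_mul]

theorem reflect_apply (v : EuclideanSpace ℝ (Fin m)) (i : Fin m) :
    reflect i₀ v i = (flipSign i₀ i : ℝ) * v i := rfl

theorem reflect_reflect (v : EuclideanSpace ℝ (Fin m)) : reflect i₀ (reflect i₀ v) = v := by
  ext i
  rw [reflect_apply, reflect_apply, flipSign_mul_cancel]

theorem reflect_E (j : Fin m) : reflect i₀ (E j) = (flipSign i₀ j : ℝ) • E j := by
  ext i
  rw [reflect_apply]
  by_cases h : i = j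
  · subst h; simp
  · simp [h]

theorem vec_smul (c : ℝ) (v : EuclideanSpace ℝ (Fin m)) : vec (c • v) = c • vec v :=
  map_smul _ c v

theorem vec_sq (v : EuclideanSpace ℝ (Fin m)) :
    vec v * vec v = -algebraMap ℝ (Cl m) (inner ℝ v v) := by
  rw [vec, CliffordAlgebra.ι_sq_scalar, negForm_apply, map_neg]

theorem vec_mul_add_swap (v w : EuclideanSpace ℝ (Fin m)) :
    vec v * vec w + vec w * vec v = -algebraMap ℝ (Cl m) (2 * inner ℝ v w) := by
  rw [vec, vec, CliffordAlgebra.ι_mul_ι_add_swap, ← map_neg]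
  congr 1
  rw [QuadraticMap.polar, negForm_apply, negForm_apply, negForm_apply, inner_add_left,
    inner_add_right, inner_add_right, real_inner_comm v w]
  ring

theorem inner_E (v : EuclideanSpace ℝ (Fin m)) (i : Fin m) : inner ℝ (E i) v = v i := by
  rw [EuclideanSpace.inner_single_left, map_one, one_mul]

theorem vec_E_sq (i : Fin m) : vec (E i) * vec (E i) = -1 := by
  rw [vec_sq]; simp

theorem vec_E_anticomm {i j : Fin m} (h : i ≠ j) :
    vec (E i) * vec (E j) = -(vec (E j) * vec (E i)) := by
  rw [eq_neg_iff_add_eq_zero, vec_mul_add_swap, inner_E]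
  simp [h]

theorem star_vec_E (i : Fin m) : star (vec (E i)) = -vec (E i) := CliffordAlgebra.star_ι _

/-- `E_{i₀} · v · E_{i₀}` is the reflection of `v`. -/
theorem vec_reflect (v : EuclideanSpace ℝ (Fin m)) :
    vec (reflect i₀ v) = vec (E i₀) * vec v * vec (E i₀) := by
  have h := vec_mul_add_swap (E i₀) v
  rw [inner_E] at h
  rw [eq_sub_of_add_eq h, sub_mul, mul_assoc, vec_E_sq, ← map_neg, ← Algebra.smul_def, ← vec_smul,
    mul_neg_one, sub_neg_eq_add, ← map_add]
  congr 1
  ext i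
  rw [reflect_apply]
  by_cases h : i = i₀
  · subst h; simp [flipSign]; ring
  · simp [flipSign, h]

/-- The automorphism of the Clifford algebra induced by the reflection. -/
def reflectCl : Cl m →ₐ[ℝ] Cl m := CliffordAlgebra.map (reflect i₀)

theorem reflectCl_vec (v : EuclideanSpace ℝ (Fin m)) :
    reflectCl i₀ (vec v) = vec (reflect i₀ v) :=
  CliffordAlgebra.map_apply_ι _ v

theorem reflectCl_reflectCl (a : Cl m) : reflectCl i₀ (reflectCl i₀ a) = a := by
  have h : (reflectCl i₀).comp (reflectCl i₀) = AlgHom.id ℝ (Cl m) := by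
    apply CliffordAlgebra.hom_ext
    ext v : 1
    change reflectCl i₀ (reflectCl i₀ (vec v)) = vec v
    rw [reflectCl_vec, reflectCl_vec, reflect_reflect]
  exact congrArg (fun f => f a) h

/-- Both sides are multiplicative in `a`, the right one because `star E · E = 1`, and on vectors
both give `-r(v)`. This expresses `r` through conjugation by an element of the pin group. -/
theorem involute_reflectCl (a : Cl m) :
    CliffordAlgebra.involute (reflectCl i₀ a) = vec (E i₀) * a * star (vec (E i₀)) := by
  rw [star_vec_E]
  induction a using CliffordAlgebra.induction with
  | algebraMap r =>
    rw [AlgHom.commutes, AlgHom.commutes, ← Algebra.commutes, mul_assoc, mul_neg, vec_E_sq,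
      neg_neg, mul_one]
  | ι v =>
    change CliffordAlgebra.involute (reflectCl i₀ (vec v)) = vec (E i₀) * vec v * -vec (E i₀)
    rw [reflectCl_vec, vec, CliffordAlgebra.involute_ι, ← vec, vec_reflect, mul_neg]
  | mul a b ha hb =>
    rw [map_mul, map_mul, ha, hb]
    calc _ = vec (E i₀) * a * -(vec (E i₀) * vec (E i₀)) * b * -vec (E i₀) := by
            simp only [mul_assoc, neg_mul, mul_neg]
      _ = _ := by rw [vec_E_sq, neg_neg, mul_one]; simp only [mul_assoc]
  | add a b ha hb => rw [map_add, map_add, ha, hb, mul_add, add_mul]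

theorem vec_E_mem_pinGroup (i : Fin m) : vec (E i) ∈ pinGroup (negForm m) := by
  let e : (Cl m)ˣ := ⟨vec (E i), -vec (E i), by rw [mul_neg, vec_E_sq, neg_neg],
    by rw [neg_mul, vec_E_sq, neg_neg]⟩
  refine (pinGroup.units_mem_iff (x := e)).2 ⟨Subgroup.subset_closure ⟨E i, rfl⟩, ?_⟩
  rw [Unitary.mem_iff]
  change star (vec (E i)) * vec (E i) = 1 ∧ vec (E i) * star (vec (E i)) = 1
  rw [star_vec_E, neg_mul, mul_neg, vec_E_sq, neg_neg]
  exact ⟨rfl, rfl⟩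

theorem vec_E_conj_mem_spinGroup (i : Fin m) {a : Cl m} (ha : a ∈ spinGroup (negForm m)) :
    vec (E i) * a * star (vec (E i)) ∈ spinGroup (negForm m) := by
  refine spinGroup.mem_iff.2 ⟨mul_mem (mul_mem (vec_E_mem_pinGroup i) (spinGroup.mem_pin ha))
    (pinGroup.star_mem (vec_E_mem_pinGroup i)), ?_⟩
  have h1 := CliffordAlgebra.ι_mem_evenOdd_one (negForm m) (E i)
  have h2 : a ∈ CliffordAlgebra.evenOdd (negForm m) 0 := spinGroup.mem_even ha
  have h3 := SetLike.mul_mem_graded (SetLike.mul_mem_graded h1 h2) h1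
  rw [star_vec_E, mul_neg]
  -- The product odd · even · odd has degree `1 + 0 + 1 = 0` in `ZMod 2`.
  exact neg_mem (S := Subalgebra ℝ (Cl m)) h3

/-- The grading involution fixes the even elements of the spin group, so by `involute_reflectCl` the
reflection of `a` is the conjugate of `a` by `E_{i₀}`. -/
theorem reflectCl_mem_spinGroup {a : Cl m} (ha : a ∈ spinGroup (negForm m)) :
    reflectCl i₀ a ∈ spinGroup (negForm m) := by
  have h1 := vec_E_conj_mem_spinGroup i₀ ha
  have h2 := spinGroup.involute_eq h1
  rw [← involute_reflectCl, CliffordAlgebra.involute_involute] at h2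
  rw [h2, involute_reflectCl]
  exact h1

/-- The automorphism of `Spin(m)` induced by the reflection. -/
def reflectSpin : Spin m →* Spin m where
  toFun B := ⟨reflectCl i₀ B, reflectCl_mem_spinGroup i₀ B.2⟩
  map_one' := Subtype.ext (map_one (reflectCl i₀))
  map_mul' B C := Subtype.ext (map_mul (reflectCl i₀) (B : Cl m) C)

theorem coe_reflectSpin (B : Spin m) : (reflectSpin i₀ B : Cl m) = reflectCl i₀ B := rfl

theorem reflectSpin_reflectSpin (B : Spin m) : reflectSpin i₀ (reflectSpin i₀ B) = B :=
  Subtype.ext (reflectCl_reflectCl i₀ B)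

/-- For the module topology every linear map is continuous. -/
theorem continuous_reflectSpin : Continuous (reflectSpin i₀) := by
  have : IsModuleTopology ℝ (Cl m) := ⟨rfl⟩
  have : ContinuousAdd (Cl m) := IsModuleTopology.toContinuousAdd ℝ (Cl m)
  have h : Continuous (reflectCl i₀) :=
    IsModuleTopology.continuous_of_linearMap (reflectCl i₀).toLinearMap
  exact Continuous.subtype_mk (h.comp continuous_subtype_val) _

/-- `reflectSpin` as a homeomorphism. -/
def reflectSpinHomeomorph : Spin m ≃ₜ Spin m where
  toFun := reflectSpin i₀
  invFun := reflectSpin i₀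
  left_inv := reflectSpin_reflectSpin i₀
  right_inv := reflectSpin_reflectSpin i₀
  continuous_toFun := continuous_reflectSpin i₀
  continuous_invFun := continuous_reflectSpin i₀

theorem spinAction_smul (B : Spin m) (c : ℝ) (v : EuclideanSpace ℝ (Fin m)) :
    spinAction B (c • v) = c • spinAction B v := by
  apply vec_injective
  rw [vec_smul, vec_spinAction, vec_spinAction, vec_smul, mul_smul_comm, smul_mul_assoc]

/-- As `r` is an involutive algebra automorphism, `r(B) v r(B)⁻¹ = r(B r(v) B⁻¹)`. -/
theorem spinAction_reflectSpin (B : Spin m) (v : EuclideanSpace ℝ (Fin m)) :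
    spinAction (reflectSpin i₀ B) v = reflect i₀ (spinAction B (reflect i₀ v)) := by
  apply vec_injective
  rw [vec_spinAction, ← reflectCl_vec, vec_spinAction, map_mul, map_mul, reflectCl_vec,
    reflect_reflect, ← map_inv]
  rfl

theorem spinMatrix_reflectSpin (B : Spin m) (i j : Fin m) :
    spinMatrix (reflectSpin i₀ B) i j = flipSign i₀ i * flipSign i₀ j * spinMatrix B i j := by
  change spinAction (reflectSpin i₀ B) (E j) i = _ * spinAction B (E j) i
  rw [spinAction_reflectSpin, reflect_apply, reflect_E, spinAction_smul, PiLp.smul_apply,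
    smul_eq_mul, mul_assoc]

end Reflection

/-! ### Volume elements -/

section Volume

variable {m : ℕ} (i₀ : Fin m)

theorem list_prod_ofFn_smul {R A : Type*} [CommSemiring R] [Semiring A] [Algebra R A] :
    ∀ {n : ℕ} (r : Fin n → R) (a : Fin n → A),
      (List.ofFn fun i => r i • a i).prod = (∏ i, r i) • (List.ofFn a).prod
  | 0, _, _ => by simp
  | n + 1, r, a => by
    rw [List.ofFn_succ, List.ofFn_succ, List.prod_cons, List.prod_cons, list_prod_ofFn_smul,
      Fin.prod_univ_succ, smul_mul_smul_comm]

theorem mul_list_prod_ofFn {R A : Type*} [CommSemiring R] [Semiring A] [Algebra R A] (x : A) :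
    ∀ {n : ℕ} (r : Fin n → R) (a : Fin n → A), (∀ i, x * a i = r i • (a i * x)) →
      x * (List.ofFn a).prod = (∏ i, r i) • ((List.ofFn a).prod * x)
  | 0, _, _, _ => by simp
  | n + 1, r, a, h => by
    rw [List.ofFn_succ, List.prod_cons, ← mul_assoc, h 0, smul_mul_assoc, mul_assoc (a 0) x,
      mul_list_prod_ofFn x (fun i => r i.succ) (fun i => a i.succ) (fun i => h i.succ),
      Fin.prod_univ_succ, mul_smul_comm, smul_smul, mul_assoc]

/-- The real volume element `E_1 ⋯ E_m`. -/
def realVolume (m : ℕ) : Cl m := (List.ofFn fun i : Fin m => vec (E i)).prod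

theorem complexVolume_eq (m : ℕ) : complexVolume m = volFactor m ⊗ₜ[ℝ] realVolume m := rfl

/-- Exactly one factor of `E_1 ⋯ E_m` changes sign. All exchanges of half-spinors and of `Σ` with
`Σ^#` come from this sign. -/
theorem reflectCl_realVolume : reflectCl i₀ (realVolume m) = -realVolume m := by
  have h : (reflectCl i₀ ∘ fun i : Fin m => vec (E i)) =
      fun i : Fin m => (flipSign i₀ i : ℝ) • vec (E i) := by
    ext i
    rw [Function.comp_apply, reflectCl_vec, reflect_E, vec_smul]
  rw [realVolume, map_list_prod, List.map_ofFn, h, list_prod_ofFn_smul, prod_flipSign,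
    neg_one_smul]

theorem realVolume_mem_pinGroup (m : ℕ) : realVolume m ∈ pinGroup (negForm m) := by
  refine Submonoid.list_prod_mem _ fun x hx => ?_
  obtain ⟨i, rfl⟩ := (List.mem_ofFn' _ _).1 hx
  exact vec_E_mem_pinGroup i

theorem vec_E_mul_realVolume (hm : Even m) (j : Fin m) :
    vec (E j) * realVolume m = -(realVolume m * vec (E j)) := by
  -- `E_j` commutes with itself and anticommutes with the other factors; the signs `-r_i`, with the
  -- reflection taken at `j`, encode this and multiply to `(-1)^m · (-1)`.
  have h := mul_list_prod_ofFn (vec (E j)) (fun i => -(flipSign j i : ℝ))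
    (fun i : Fin m => vec (E i)) fun i => by
      by_cases hij : i = j
      · subst hij; simp [flipSign]
      · rw [vec_E_anticomm (Ne.symm hij)]; simp [flipSign, hij]
  rw [Finset.prod_neg, prod_flipSign, Finset.card_univ, Fintype.card_fin, hm.neg_one_pow, one_mul,
    neg_one_smul] at h
  exact h

/-- The automorphism of the complexified Clifford algebra induced by the reflection. -/
def reflectCx : (ℂ ⊗[ℝ] Cl m) →ₐ[ℂ] (ℂ ⊗[ℝ] Cl m) :=
  Algebra.TensorProduct.map (AlgHom.id ℂ ℂ) (reflectCl i₀)

theorem reflectCx_tmul (c : ℂ) (a : Cl m) :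
    reflectCx i₀ (c ⊗ₜ[ℝ] a) = c ⊗ₜ[ℝ] reflectCl i₀ a := rfl

theorem reflectCx_reflectCx (a : ℂ ⊗[ℝ] Cl m) : reflectCx i₀ (reflectCx i₀ a) = a := by
  induction a using TensorProduct.induction_on with
  | zero => rw [map_zero, map_zero]
  | tmul c a => rw [reflectCx_tmul, reflectCx_tmul, reflectCl_reflectCl]
  | add a b ha hb => rw [map_add, map_add, ha, hb]

theorem reflectCx_complexVolume :
    reflectCx i₀ (complexVolume m) = -complexVolume m := by
  rw [complexVolume_eq, reflectCx_tmul, reflectCl_realVolume, TensorProduct.tmul_neg]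

end Volume

/-! ### Intertwiners of Clifford modules -/

section Intertwiner

variable {m : ℕ} {S S' : Type*}

theorem vec_eq_sum (v : EuclideanSpace ℝ (Fin m)) : vec v = ∑ i, v i • vec (E i) := by
  have h : v = ∑ i, v i • E i := by
    ext i
    simp [Finset.sum_apply, Pi.single_apply]
  conv_lhs => rw [h, vec, map_sum]
  simp only [map_smul]

/-- A linear map that intertwines the actions of the basis vectors intertwines the
representations of the complexified Clifford algebra. -/
theorem intertwines_of_vec [AddCommGroup S] [Module ℂ S] [AddCommGroup S'] [Module ℂ S']
    (ρ' : (ℂ ⊗[ℝ] Cl m) →ₐ[ℂ] Module.End ℂ S') (ρ : (ℂ ⊗[ℝ] Cl m) →ₐ[ℂ] Module.End ℂ S)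
    (A : S' →ₗ[ℂ] S)
    (h : ∀ i s, A (ρ' (1 ⊗ₜ[ℝ] vec (E i)) s) = ρ (1 ⊗ₜ[ℝ] vec (E i)) (A s))
    (a : ℂ ⊗[ℝ] Cl m) (s : S') : A (ρ' a s) = ρ a (A s) := by
  have hr : ∀ (r : ℝ) (a : Cl m), (1 : ℂ) ⊗ₜ[ℝ] (r • a) = (r : ℂ) • ((1 : ℂ) ⊗ₜ[ℝ] a) := by
    intro r a
    rw [← TensorProduct.smul_tmul, TensorProduct.smul_tmul']
    simp
  have key : ∀ (a : Cl m) (s : S'), A (ρ' (1 ⊗ₜ[ℝ] a) s) = ρ (1 ⊗ₜ[ℝ] a) (A s) := by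
    intro a
    induction a using CliffordAlgebra.induction with
    | algebraMap r =>
      intro s
      rw [Algebra.algebraMap_eq_smul_one, hr, ← Algebra.TensorProduct.one_def, map_smul, map_smul,
        map_one, map_one]
      simp
    | ι v =>
      intro s
      change A (ρ' (1 ⊗ₜ[ℝ] vec v) s) = ρ (1 ⊗ₜ[ℝ] vec v) (A s)
      rw [vec_eq_sum]
      simp only [TensorProduct.tmul_sum, hr, map_sum, map_smul, LinearMap.sum_apply,
        LinearMap.smul_apply, h]
    | mul a b ha hb =>
      intro s
      have e : (1 : ℂ) ⊗ₜ[ℝ] (a * b) = (1 ⊗ₜ[ℝ] a) * (1 ⊗ₜ[ℝ] b) := by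
        rw [Algebra.TensorProduct.tmul_mul_tmul, one_mul]
      rw [e, map_mul, map_mul, Module.End.mul_apply, Module.End.mul_apply, ha, hb]
    | add a b ha hb =>
      intro s
      simp only [TensorProduct.tmul_add, map_add, LinearMap.add_apply, ha, hb]
  induction a using TensorProduct.induction_on with
  | zero => simp
  | tmul c a =>
    have e : c ⊗ₜ[ℝ] a = c • ((1 : ℂ) ⊗ₜ[ℝ] a) := by
      rw [TensorProduct.smul_tmul', smul_eq_mul, mul_one]
    rw [e, map_smul, map_smul, LinearMap.smul_apply, map_smul, key, LinearMap.smul_apply]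
  | add a b ha hb => simp only [map_add, LinearMap.add_apply, ha, hb]

variable [AddCommGroup S] [Module ℂ S] [AddCommGroup S'] [Module ℂ S']

/-- `A - x A y` intertwines `x` and `y` if these square to `-1`. -/
theorem average_intertwines {x : Module.End ℂ S} {y : Module.End ℂ S'} (hx : ∀ s, x (x s) = -s)
    (hy : ∀ s, y (y s) = -s) (A : S' →ₗ[ℂ] S) (s : S') :
    (A - x ∘ₗ A ∘ₗ y) (y s) = x ((A - x ∘ₗ A ∘ₗ y) s) := by
  simp [hx, hy, add_comm]

/-- Moving `t` through `x A y` costs one sign at `y` and one at `x`, and these cancel. Averaging at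
one index therefore keeps the relations already achieved at others. -/
theorem average_intertwines_of_anticomm {x z : Module.End ℂ S} {y t : Module.End ℂ S'}
    (hx : ∀ s, x (z s) = -z (x s)) (hy : ∀ s, y (t s) = -t (y s)) {A : S' →ₗ[ℂ] S}
    (hA : ∀ s, A (t s) = z (A s)) (s : S') :
    (A - x ∘ₗ A ∘ₗ y) (t s) = z ((A - x ∘ₗ A ∘ₗ y) s) := by
  simp [hx, hy, hA]

/-- Two systems of anticommuting endomorphisms with squares `-1` admit a nonzero map intertwining
all but one given pair of them. -/
theorem exists_intertwines_finset [Nontrivial S] [Nontrivial S']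
    {x : Fin m → Module.End ℂ S} {y : Fin m → Module.End ℂ S'}
    (hx : ∀ i s, x i (x i s) = -s) (hy : ∀ i s, y i (y i s) = -s)
    (hx' : ∀ i j, i ≠ j → ∀ s, x i (x j s) = -x j (x i s))
    (hy' : ∀ i j, i ≠ j → ∀ s, y i (y j s) = -y j (y i s)) (i₀ : Fin m) (K : Finset (Fin m))
    (hK : i₀ ∉ K) : ∃ A : S' →ₗ[ℂ] S, A ≠ 0 ∧ ∀ j ∈ K, ∀ s, A (y j s) = x j (A s) := by
  induction K using Finset.induction_on with
  | empty =>
    obtain ⟨A, hA⟩ := exists_ne (0 : S' →ₗ[ℂ] S)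
    exact ⟨A, hA, by simp⟩
  | insert k K hk ih =>
    have hki : k ≠ i₀ := fun h => hK (h ▸ Finset.mem_insert_self _ _)
    have hiK : i₀ ∉ K := fun h => hK (Finset.mem_insert_of_mem h)
    obtain ⟨A, hA0, hA⟩ := ih hiK
    by_cases hB : A - x k ∘ₗ A ∘ₗ y k = 0
    -- A vanishing average means that `A` intertwines `x k` and `y k` up to the sign `-1`.
    · have hB' : ∀ s, A s = x k (A (y k s)) := fun s => by
        simpa [sub_eq_zero] using congrArg (fun f => f s) hB
      have hk' : ∀ s, x k (A s) = -A (y k s) := fun s => by rw [hB' s, hx]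
      -- Precomposition with `y k ∘ y i₀` repairs that sign: the product anticommutes with `y k` and
      -- commutes with `y j` for `j` in `K`. The index `i₀` is kept out of the induction to be
      -- available here.
      refine ⟨A ∘ₗ y k ∘ₗ y i₀, fun h0 => hA0 ?_, fun j hj s => ?_⟩
      · ext s
        have := congrArg (fun f => f (y i₀ (y k s))) h0
        simpa [hy] using this
      · rcases Finset.mem_insert.1 hj with rfl | hj
        · simp [hk', hy, hy' i₀ j hki.symm]
        · have h1 : j ≠ k := fun h => hk (h ▸ hj)
          have h2 : j ≠ i₀ := fun h => hiK (h ▸ hj)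
          simp [← hA j hj, hy' j k h1, hy' j i₀ h2]
    · refine ⟨_, hB, fun j hj s => ?_⟩
      rcases Finset.mem_insert.1 hj with rfl | hj
      · exact average_intertwines (hx j) (hy j) A s
      · have h1 : k ≠ j := fun h => hk (h ▸ hj)
        exact average_intertwines_of_anticomm (hx' k j h1) (hy' k j h1) (hA j hj) s

/-- Two systems of anticommuting endomorphisms with squares `-1` admit a nonzero map intertwining
them, possibly up to a sign at one given index. -/
theorem exists_intertwines_or [Nontrivial S] [Nontrivial S']
    {x : Fin m → Module.End ℂ S} {y : Fin m → Module.End ℂ S'}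
    (hx : ∀ i s, x i (x i s) = -s) (hy : ∀ i s, y i (y i s) = -s)
    (hx' : ∀ i j, i ≠ j → ∀ s, x i (x j s) = -x j (x i s))
    (hy' : ∀ i j, i ≠ j → ∀ s, y i (y j s) = -y j (y i s)) (i₀ : Fin m) :
    ∃ A : S' →ₗ[ℂ] S, A ≠ 0 ∧ ((∀ j s, A (y j s) = x j (A s)) ∨
      ∀ j s, A (y j s) = (flipSign i₀ j : ℝ) • x j (A s)) := by
  obtain ⟨A, hA0, hA⟩ := exists_intertwines_finset hx hy hx' hy' i₀ (Finset.univ.erase i₀)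
    (Finset.notMem_erase _ _)
  have hA' : ∀ j, j ≠ i₀ → ∀ s, A (y j s) = x j (A s) := fun j hj =>
    hA j (Finset.mem_erase.2 ⟨hj, Finset.mem_univ _⟩)
  -- At the last index no spare generator is left to repair a sign, hence the alternative.
  by_cases hB : A - x i₀ ∘ₗ A ∘ₗ y i₀ = 0
  · refine ⟨A, hA0, Or.inr fun j s => ?_⟩
    by_cases hj : j = i₀
    · subst hj
      have := congrArg (fun f => f s) hB
      have hB' : A s = x j (A (y j s)) := by simpa [sub_eq_zero] using this
      rw [hB', hx]
      simp [flipSign]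
    · simp [flipSign, hj, hA' j hj]
  · refine ⟨_, hB, Or.inl fun j s => ?_⟩
    by_cases hj : j = i₀
    · subst hj
      exact average_intertwines (hx j) (hy j) A s
    · exact average_intertwines_of_anticomm (hx' i₀ j (Ne.symm hj)) (hy' i₀ j (Ne.symm hj))
        (hA' j hj) s

end Intertwiner

/-! ### Isometric intertwiners of spinor modules -/

namespace SpinorModule

variable {m : ℕ} {S S' : Type*} [NormedAddCommGroup S] [InnerProductSpace ℂ S]
  [NormedAddCommGroup S'] [InnerProductSpace ℂ S']

theorem act_act (σ : SpinorModule m S) (a b : Cl m) (s : S) :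
    σ.act a (σ.act b s) = σ.act (a * b) s := by
  rw [act_mul, Module.End.mul_apply]

theorem act_vec_E_sq (σ : SpinorModule m S) (i : Fin m) (s : S) :
    σ.act (vec (E i)) (σ.act (vec (E i)) s) = -s := by
  rw [act_act, vec_E_sq, act_neg, act_one, LinearMap.neg_apply, Module.End.one_apply]

theorem act_vec_E_anticomm (σ : SpinorModule m S) {i j : Fin m} (h : i ≠ j) (s : S) :
    σ.act (vec (E i)) (σ.act (vec (E j)) s) = -σ.act (vec (E j)) (σ.act (vec (E i)) s) := by
  rw [act_act, vec_E_anticomm h, act_neg, LinearMap.neg_apply, act_act]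

theorem act_smul (σ : SpinorModule m S) (r : ℝ) (a : Cl m) : σ.act (r • a) = r • σ.act a := by
  have h : (1 : ℂ) ⊗ₜ[ℝ] (r • a) = (r : ℂ) • ((1 : ℂ) ⊗ₜ[ℝ] a) := by
    rw [← TensorProduct.smul_tmul, TensorProduct.smul_tmul']
    simp
  rw [act, h, map_smul]
  ext s
  simp [act]

theorem norm_act_of_mem_pinGroup (σ : SpinorModule m S) {a : Cl m}
    (ha : a ∈ pinGroup (negForm m)) (s : S) : ‖σ.act a s‖ = ‖s‖ := by
  have h : inner ℂ (σ.act a s) (σ.act a s) = inner ℂ s s := by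
    rw [inner_act, act_act, pinGroup.star_mul_self_of_mem ha, act_one, Module.End.one_apply]
  rw [inner_self_eq_norm_sq_to_K, inner_self_eq_norm_sq_to_K] at h
  have h2 : ‖σ.act a s‖ ^ 2 = ‖s‖ ^ 2 := by exact_mod_cast h
  exact (sq_eq_sq₀ (norm_nonneg _) (norm_nonneg _)).1 h2

/-- `T` intertwines `σ'` with the composition of `σ` and the reflection in `E_{i₀}`. -/
def ReflectIntertwines (i₀ : Fin m) (σ' : SpinorModule m S') (σ : SpinorModule m S)
    (T : S' →ₗ[ℂ] S) : Prop :=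
  ∀ (a : ℂ ⊗[ℝ] Cl m) (s : S'), T (σ'.rep a s) = σ.rep (reflectCx i₀ a) (T s)

theorem ReflectIntertwines.act {i₀ : Fin m} {σ' : SpinorModule m S'} {σ : SpinorModule m S}
    {T : S' →ₗ[ℂ] S} (h : ReflectIntertwines i₀ σ' σ T) (a : Cl m) (s : S') :
    T (σ'.act a s) = σ.act (reflectCl i₀ a) (T s) := h _ s

/-- The composition of `σ` with the reflection is again a representation, so the relation need only
be tested on generators. -/
theorem reflectIntertwines_of_vec {i₀ : Fin m} {σ' : SpinorModule m S'} {σ : SpinorModule m S}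
    {T : S' →ₗ[ℂ] S}
    (h : ∀ j s, T (σ'.act (vec (E j)) s) = (flipSign i₀ j : ℝ) • σ.act (vec (E j)) (T s)) :
    ReflectIntertwines i₀ σ' σ T := by
  refine intertwines_of_vec σ'.rep (σ.rep.comp (reflectCx i₀)) T fun j s => ?_
  change T (σ'.act (vec (E j)) s) = σ.act (reflectCl i₀ (vec (E j))) (T s)
  rw [h, reflectCl_vec, reflect_E, vec_smul, act_smul, LinearMap.smul_apply]

/-- **Schur's lemma.** A nonzero intertwiner of irreducible Hermitian modules is, up to a factor,
an isometric isomorphism. -/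
theorem ReflectIntertwines.exists_isometry [FiniteDimensional ℂ S] [FiniteDimensional ℂ S']
    {i₀ : Fin m} {σ' : SpinorModule m S'} {σ : SpinorModule m S} {A : S' →ₗ[ℂ] S}
    (h : ReflectIntertwines i₀ σ' σ A) (hA : A ≠ 0) :
    ∃ T : S' ≃ₗᵢ[ℂ] S, ReflectIntertwines i₀ σ' σ T.toLinearEquiv := by
  have := σ'.nontrivial
  have hker : LinearMap.ker A = ⊥ := by
    refine (σ'.irreducible _ fun a s hs => ?_).resolve_right fun h1 => hA (LinearMap.ker_eq_top.1 h1)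
    rw [LinearMap.mem_ker] at hs ⊢
    rw [h, hs, map_zero]
  have hrange : LinearMap.range A = ⊤ := by
    refine (σ.irreducible _ ?_).resolve_left fun h1 => hA (LinearMap.range_eq_bot.1 h1)
    rintro a _ ⟨s, rfl⟩
    -- Since the reflection is an involution, `σ(a) A s = A σ'(r a) s`.
    exact ⟨σ'.rep (reflectCx i₀ a) s, by rw [h, reflectCx_reflectCx]⟩
  let D : Module.End ℂ S' := A.adjoint ∘ₗ A
  -- Vectors act skew on both modules, so moving one across `A* A` produces two signs which cancel.
  -- By irreducibility an eigenspace of `D` is then everything.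
  have hD : ∀ a s, D (σ'.rep a s) = σ'.rep a (D s) := by
    refine intertwines_of_vec σ'.rep σ'.rep D fun i s => ext_inner_right ℂ fun t => ?_
    have e1 : A (σ'.rep (1 ⊗ₜ[ℝ] vec (E i)) s) =
        σ.rep (1 ⊗ₜ[ℝ] vec (reflect i₀ (E i))) (A s) := by
      rw [h, reflectCx_tmul, reflectCl_vec]
    have e2 : A (σ'.rep (1 ⊗ₜ[ℝ] vec (E i)) t) =
        σ.rep (1 ⊗ₜ[ℝ] vec (reflect i₀ (E i))) (A t) := by
      rw [h, reflectCx_tmul, reflectCl_vec]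
    rw [σ'.skew]
    change inner ℂ (A.adjoint (A _)) t = -inner ℂ (A.adjoint (A s)) _
    rw [LinearMap.adjoint_inner_left, LinearMap.adjoint_inner_left, e1, e2, σ.skew]
  obtain ⟨μ, hμ⟩ := Module.End.exists_eigenvalue D
  have htop : D.eigenspace μ = ⊤ := by
    refine (σ'.irreducible _ fun a s hs => ?_).resolve_left hμ
    rw [Module.End.mem_eigenspace_iff] at hs ⊢
    rw [hD, hs, map_smul]
  -- Comparing real parts avoids proving separately that `μ` is real.
  have hnorm : ∀ s, ‖A s‖ ^ 2 = μ.re * ‖s‖ ^ 2 := fun s => by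
    have e : D s = μ • s := Module.End.mem_eigenspace_iff.1 (htop ▸ Submodule.mem_top)
    have e1 : inner ℂ (A s) (A s) = μ * inner ℂ s s := by
      rw [← LinearMap.adjoint_inner_right]
      change inner ℂ s (D s) = _
      rw [e, inner_smul_right]
    rw [inner_self_eq_norm_sq_to_K, inner_self_eq_norm_sq_to_K] at e1
    have e2 : ((‖A s‖ ^ 2 : ℝ) : ℂ) = μ * ((‖s‖ ^ 2 : ℝ) : ℂ) := by
      push_cast
      exact e1
    simpa only [Complex.ofReal_re, Complex.re_mul_ofReal] using congrArg Complex.re e2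
  obtain ⟨s₀, hs₀⟩ := exists_ne (0 : S')
  have hpos : 0 < μ.re := by
    have h1 : 0 < ‖A s₀‖ ^ 2 := by
      have : A s₀ ≠ 0 := fun h0 => hs₀ (LinearMap.ker_eq_bot.1 hker (h0.trans (map_zero A).symm))
      positivity
    rw [hnorm] at h1
    exact pos_of_mul_pos_left h1 (by positivity)
  -- As `A` scales norms by `√(Re μ)`, this factor makes it isometric.
  let c : ℝ := (Real.sqrt μ.re)⁻¹
  have hc : 0 < c := inv_pos.2 (Real.sqrt_pos.2 hpos)
  have hiso : ∀ s, ‖((c : ℂ) • A) s‖ = ‖s‖ := fun s => by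
    refine (sq_eq_sq₀ (norm_nonneg _) (norm_nonneg _)).1 ?_
    rw [LinearMap.smul_apply, norm_smul, mul_pow, hnorm, Complex.norm_real, Real.norm_of_nonneg
      hc.le, inv_pow, Real.sq_sqrt hpos.le, inv_mul_cancel_left₀ hpos.ne']
  have hsurj : Function.Surjective ((c : ℂ) • A) := fun t => by
    obtain ⟨s, hs⟩ := LinearMap.range_eq_top.1 hrange ((c : ℂ)⁻¹ • t)
    refine ⟨s, ?_⟩
    rw [LinearMap.smul_apply, hs, smul_inv_smul₀]
    exact_mod_cast hc.ne'
  refine ⟨LinearIsometryEquiv.ofSurjective ⟨(c : ℂ) • A, hiso⟩ hsurj, fun a s => ?_⟩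
  change (c : ℂ) • A (σ'.rep a s) = σ.rep _ ((c : ℂ) • A s)
  rw [h, map_smul]

/-- Spinor modules on which the volume element acts by opposite nonzero scalars are related by the
reflection. -/
theorem exists_reflectIntertwines_of_scalar [FiniteDimensional ℂ S] [FiniteDimensional ℂ S']
    (i₀ : Fin m) (σ' : SpinorModule m S') (σ : SpinorModule m S) {c : ℂ} (hc : c ≠ 0)
    (h' : σ'.rep (complexVolume m) = c • 1) (h : σ.rep (complexVolume m) = -(c • 1)) :
    ∃ T : S' ≃ₗᵢ[ℂ] S, ReflectIntertwines i₀ σ' σ T.toLinearEquiv := by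
  have := σ.nontrivial
  have := σ'.nontrivial
  obtain ⟨A, hA0, hA | hA⟩ := exists_intertwines_or σ.act_vec_E_sq σ'.act_vec_E_sq
    (fun i j hij => σ.act_vec_E_anticomm hij) (fun i j hij => σ'.act_vec_E_anticomm hij) i₀
  -- A true intertwiner would satisfy `c A = -c A`, so it would vanish.
  · refine absurd ?_ hA0
    have key := intertwines_of_vec σ'.rep σ.rep A hA (complexVolume m)
    ext s
    have e := key s
    rw [h', h] at e
    simp only [LinearMap.smul_apply, LinearMap.neg_apply, Module.End.one_apply, map_smul] at e
    have e2 : (2 * c) • A s = 0 := by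
      rw [mul_smul, two_smul]
      exact eq_neg_iff_add_eq_zero.1 e
    exact (smul_eq_zero.1 e2).resolve_left (mul_ne_zero two_ne_zero hc)
  · exact (reflectIntertwines_of_vec hA).exists_isometry hA0

/-- For `m` even, `σ(ω) σ(E_{i₀})` relates `σ` to its composition with the reflection. -/
theorem exists_reflectIntertwines_of_even [FiniteDimensional ℂ S] (hm : Even m) (i₀ : Fin m)
    (σ : SpinorModule m S) :
    ∃ T : S ≃ₗᵢ[ℂ] S, ReflectIntertwines i₀ σ σ T.toLinearEquiv := by
  have hmem : realVolume m * vec (E i₀) ∈ pinGroup (negForm m) :=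
    mul_mem (realVolume_mem_pinGroup m) (vec_E_mem_pinGroup i₀)
  let A : S →ₗᵢ[ℂ] S := ⟨σ.act (realVolume m * vec (E i₀)), σ.norm_act_of_mem_pinGroup hmem⟩
  refine ⟨LinearIsometryEquiv.ofSurjective A fun t => ⟨σ.act (star (realVolume m * vec (E i₀))) t,
    ?_⟩, reflectIntertwines_of_vec fun j s => ?_⟩
  · change σ.act _ (σ.act _ t) = t
    rw [act_act, pinGroup.mul_star_self_of_mem hmem, act_one, Module.End.one_apply]
  · change σ.act _ (σ.act _ s) = _ • σ.act _ (σ.act _ s)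
    rw [act_act, act_act, ← LinearMap.smul_apply, ← act_smul]
    congr 2
    -- `ω` anticommutes with every `E_j`. Hence `ω E_{i₀}` anticommutes with `E_{i₀}` and commutes
    -- with the other `E_j`, where two signs cancel.
    rw [← mul_assoc (vec (E j)), vec_E_mul_realVolume hm, mul_assoc, neg_mul, mul_assoc]
    by_cases hj : j = i₀
    · subst hj; simp [flipSign]
    · rw [vec_E_anticomm (Ne.symm hj)]
      simp [flipSign, hj]

end SpinorModule

section Manifold

variable {m : ℕ} {M : Type*} [TopologicalSpace M] [ChartedSpace (EuclideanSpace ℝ (Fin m)) M]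
  [IsManifold (𝓡 m) ∞ M] {g : Metric m M} {O O' : ManifoldOrientation m M}

/-! ### Reflected frames -/

theorem ManifoldOrientation.neg_orient (O : ManifoldOrientation m M) (x : M) :
    (-O).orient x = -O.orient x := rfl

/-- The frame with its vector of index `i₀` negated. -/
def OrientedFrame.flip (i₀ : Fin m) (h : ∀ x, O'.orient x = -O.orient x) {x : M}
    (f : OrientedFrame g O x) : OrientedFrame g O' x where
  basis := f.basis.unitsSMul (flipSign i₀)
  orthonormal i j := by
    rw [Module.Basis.unitsSMul_apply, Module.Basis.unitsSMul_apply, Units.smul_def, Units.smul_def,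
      map_smul, map_smul, smul_apply, f.orthonormal, smul_eq_mul, smul_eq_mul]
    by_cases hij : i = j
    · subst hij; simp [flipSign_mul_self]
    · simp [hij]
  oriented := by
    rw [flipSign, Module.Basis.orientation_neg_single, f.oriented, h]

theorem OrientedFrame.flip_basis (i₀ : Fin m) (h : ∀ x, O'.orient x = -O.orient x) {x : M}
    (f : OrientedFrame g O x) (i : Fin m) :
    (f.flip i₀ h).basis i = (flipSign i₀ i : ℝ) • f.basis i :=
  Module.Basis.unitsSMul_apply i

theorem OrientedFrame.ext_basis {x : M} {f f' : OrientedFrame g O x}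
    (h : ∀ i, f.basis i = f'.basis i) : f = f' := by
  cases f
  cases f'
  congr 1
  exact Module.Basis.eq_of_apply_eq h

/-- With the orientations related pointwise by hypotheses, the second flip lands over `O` itself and
not over `-(-O)`. -/
theorem OrientedFrame.flip_flip (i₀ : Fin m) (h : ∀ x, O'.orient x = -O.orient x)
    (h' : ∀ x, O.orient x = -O'.orient x) {x : M}
    (f : OrientedFrame g O x) : (f.flip i₀ h).flip i₀ h' = f :=
  ext_basis fun i => by
    rw [flip_basis, flip_basis, smul_smul, flipSign_mul_self, one_smul]

/-- Trivializations of the tangent bundle are fibrewise linear, so near `p` the map is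
multiplication by `c` in the fibre coordinate. -/
theorem continuous_tangentBundle_smul (c : ℝ) :
    Continuous fun p : TangentBundle (𝓡 m) M => (⟨p.1, c • p.2⟩ : TangentBundle (𝓡 m) M) := by
  rw [continuous_iff_continuousAt]
  intro p
  rw [FiberBundle.continuousAt_totalSpace]
  have hp := FiberBundle.mem_baseSet_trivializationAt' (F := EuclideanSpace ℝ (Fin m))
    (E := fun x : M => TangentSpace (𝓡 m) x) p.1
  have hproj : Continuous (Bundle.TotalSpace.proj : TangentBundle (𝓡 m) M → M) :=
    FiberBundle.continuous_proj _ _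
  refine ⟨hproj.continuousAt, ?_⟩
  have hc := ((FiberBundle.continuousAt_totalSpace (EuclideanSpace ℝ (Fin m))
    (id : TangentBundle (𝓡 m) M → TangentBundle (𝓡 m) M)).1 (continuousAt_id (x := p))).2
  refine (hc.const_smul c).congr ?_
  have hev := hproj.continuousAt.eventually_mem
    ((trivializationAt (EuclideanSpace ℝ (Fin m)) (fun x : M => TangentSpace (𝓡 m) x)
      p.1).open_baseSet.mem_nhds hp)
  filter_upwards [hev] with q hq
  exact (((trivializationAt (EuclideanSpace ℝ (Fin m)) (fun x : M => TangentSpace (𝓡 m) x)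
    p.1).linear ℝ hq).map_smul c q.2).symm

/-- Negating the frame vector of index `i₀`, as a map of frame bundles. -/
def FrameBundle.flip (i₀ : Fin m) (h : ∀ x, O'.orient x = -O.orient x) (f : FrameBundle g O) :
    FrameBundle g O' :=
  ⟨f.base, f.frame.flip i₀ h⟩

theorem FrameBundle.flip_flip (i₀ : Fin m) (h : ∀ x, O'.orient x = -O.orient x)
    (h' : ∀ x, O.orient x = -O'.orient x) (f : FrameBundle g O) :
    (f.flip i₀ h).flip i₀ h' = f := by
  unfold flip
  rw [OrientedFrame.flip_flip]

theorem FrameBundle.continuous_flip (i₀ : Fin m) (h : ∀ x, O'.orient x = -O.orient x) :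
    Continuous (FrameBundle.flip (g := g) i₀ h) := by
  refine continuous_induced_rng.2 ?_
  have hc : Continuous (fun f : FrameBundle g O => ((f.base, fun i => ⟨f.base, f.frame.basis i⟩) :
      M × (Fin m → TangentBundle (𝓡 m) M))) := continuous_induced_dom
  refine hc.fst.prodMk (continuous_pi fun i => ?_)
  have e : (fun f : FrameBundle g O =>
      (⟨f.base, (f.frame.flip i₀ h).basis i⟩ : TangentBundle (𝓡 m) M)) =
      fun f => ⟨f.base, (flipSign i₀ i : ℝ) • f.frame.basis i⟩ := by
    funext f
    rw [OrientedFrame.flip_basis]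
  exact e ▸ (continuous_tangentBundle_smul (flipSign i₀ i : ℝ)).comp
    ((continuous_apply i).comp hc.snd)

/-- `FrameBundle.flip` as a homeomorphism. -/
def FrameBundle.flipHomeomorph (i₀ : Fin m) (h : ∀ x, O'.orient x = -O.orient x)
    (h' : ∀ x, O.orient x = -O'.orient x) : FrameBundle g O ≃ₜ FrameBundle g O' where
  toFun := FrameBundle.flip i₀ h
  invFun := FrameBundle.flip i₀ h'
  left_inv := FrameBundle.flip_flip i₀ h h'
  right_inv := FrameBundle.flip_flip i₀ h' h
  continuous_toFun := FrameBundle.continuous_flip i₀ h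
  continuous_invFun := FrameBundle.continuous_flip i₀ h'

/-- With `R` the diagonal matrix of signs, `f' = f A` and `A = R A' R` give `f' R = (f R) A'`,
because `R² = 1`. -/
theorem FrameBundle.IsTranslate.flip (i₀ : Fin m) (h : ∀ x, O'.orient x = -O.orient x)
    {f f' : FrameBundle g O} {A A' : Matrix (Fin m) (Fin m) ℝ} (hA : f.IsTranslate A f')
    (hA' : ∀ i j, A i j = flipSign i₀ i * flipSign i₀ j * A' i j) :
    (f.flip i₀ h).IsTranslate A' (f'.flip i₀ h) := by
  have hb := fun j => hA.basis_eq hA.1.symm rfl j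
  obtain ⟨x, F⟩ := f
  obtain ⟨x', F'⟩ := f'
  obtain rfl : x' = x := hA.1
  refine ⟨rfl, fun j => ?_⟩
  change (⟨x', (F'.flip i₀ h).basis j⟩ : TangentBundle (𝓡 m) M) =
    ⟨x', ∑ i, A' i j • (F.flip i₀ h).basis i⟩
  congr 1
  have e : F'.basis j = ∑ i, A i j • F.basis i := hb j
  rw [OrientedFrame.flip_basis, e, Finset.smul_sum]
  refine Finset.sum_congr rfl fun i _ => ?_
  rw [OrientedFrame.flip_basis, smul_smul, smul_smul, hA']
  congr 1
  linear_combination (flipSign i₀ i : ℝ) * A' i j * flipSign_mul_self i₀ j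

namespace SpinStructure

/-! ### The spin structure for the opposite orientation -/

/-- The spin structure on `(M,g,-O)` with the same total space: frames are reflected and the action
of `Spin(m)` is twisted by the corresponding automorphism. -/
def flip (i₀ : Fin m) (P : SpinStructure g O) : SpinStructure g (-O) where
  P := P.P
  cover p := (P.cover p).flip i₀ O.neg_orient
  act p B := P.act p (reflectSpin i₀ B)
  act_one p := by rw [map_one, P.act_one]
  act_mul p B C := by rw [map_mul, P.act_mul]
  continuous_act := P.continuous_act.comp
    (continuous_fst.prodMk ((continuous_reflectSpin i₀).comp continuous_snd))
  isCoveringMap := P.isCoveringMap.homeomorph_comp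
    (FrameBundle.flipHomeomorph i₀ O.neg_orient fun x => (neg_neg (O.orient x)).symm)
  two_sheeted f := by
    -- The fibre over `f` is the original fibre over the reflected frame.
    rw [← P.two_sheeted (f.flip i₀ fun x => (neg_neg (O.orient x)).symm)]
    congr 1
    ext p
    exact (FrameBundle.flipHomeomorph i₀ O.neg_orient
      fun x => (neg_neg (O.orient x)).symm).toEquiv.eq_symm_apply.symm
  equivariant p B := (P.equivariant p (reflectSpin i₀ B)).flip i₀ O.neg_orient
    (spinMatrix_reflectSpin i₀ B)
  locallyTrivial x₀ := by
    obtain ⟨U, hU, hx, h, h1, h2⟩ := P.locallyTrivial x₀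
    -- The group coordinate is reflected too, which turns the twisted action back into right
    -- multiplication.
    refine ⟨U, hU, hx,
      h.trans ((Homeomorph.refl U).prodCongr (reflectSpinHomeomorph i₀)), h1, fun p p' B hB => ?_⟩
    change reflectSpin i₀ (h p').2 = reflectSpin i₀ (h p).2 * B
    rw [h2 p p' _ hB, map_mul, reflectSpin_reflectSpin]

variable {P : SpinStructure g O}

/-- The points of the reflected spin structure over `x` are those of the given one. -/
def FiberAt.toFlip (i₀ : Fin m) {x : M} (p : P.FiberAt x) : (P.flip i₀).FiberAt x := ⟨p.1, p.2⟩

/-- The points of the reflected spin structure over `x` are those of the given one. -/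
def FiberAt.ofFlip {i₀ : Fin m} {x : M} (p : (P.flip i₀).FiberAt x) : P.FiberAt x := ⟨p.1, p.2⟩

theorem FiberAt.frame_toFlip (i₀ : Fin m) {x : M} (p : P.FiberAt x) :
    (p.toFlip i₀).frame = p.frame.flip i₀ O.neg_orient := by
  obtain ⟨p, rfl⟩ := p
  rfl

theorem FiberAt.act_toFlip (i₀ : Fin m) {x : M} (p : P.FiberAt x) (B : Spin m) :
    (p.toFlip i₀).act B = (p.act (reflectSpin i₀ B)).toFlip i₀ := rfl

theorem FiberAt.components_toFlip (i₀ : Fin m) {x : M} (p : P.FiberAt x)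
    (X : TangentSpace (𝓡 m) x) :
    (p.toFlip i₀).components X = reflect i₀ (p.components X) := by
  ext i
  change (p.toFlip i₀).frame.basis.repr X i = (flipSign i₀ i : ℝ) * p.frame.basis.repr X i
  rw [frame_toFlip]
  change (p.frame.basis.unitsSMul (flipSign i₀)).repr X i = _
  rw [Module.Basis.repr_unitsSMul, flipSign_inv]
  rfl

end SpinStructure
end Manifold

/-! ### Sign changes in the Koszul formula and the connection form -/

section Manifold

variable {m : ℕ} {M : Type*} [TopologicalSpace M] [ChartedSpace (EuclideanSpace ℝ (Fin m)) M]

/-- For a sign, unlike for a general factor handled by the product rule, no differentiability of `f`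
has to be supplied. -/
theorem dirDeriv_sign_mul {r : ℝ} (hr : r = 1 ∨ r = -1) (f : M → ℝ) (x : M)
    (X : TangentSpace (𝓡 m) x) : dirDeriv (fun y => r * f y) x X = r * dirDeriv f x X := by
  rcases hr with rfl | rfl
  · simp only [one_mul]
  · have e : (fun y => -1 * f y) = -f := by ext y; simp
    rw [e, dirDeriv, mfderiv_neg, neg_one_mul]
    rfl

theorem dirDeriv_smul {F : Type*} [NormedAddCommGroup F] [NormedSpace ℝ F] (f : M → F) (x : M)
    (a : ℝ) (X : TangentSpace (𝓡 m) x) : dirDeriv f x (a • X) = a • dirDeriv f x X :=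
  map_smul (mfderiv (𝓡 m) 𝓘(ℝ, F) f x) a X

theorem dirDeriv_clm_comp {F F' : Type*} [NormedAddCommGroup F] [NormedSpace ℝ F]
    [NormedAddCommGroup F'] [NormedSpace ℝ F'] (T : F →L[ℝ] F') {f : M → F} {x : M}
    (hf : MDifferentiableAt (𝓡 m) 𝓘(ℝ, F) f x) (X : TangentSpace (𝓡 m) x) :
    dirDeriv (fun y => T (f y)) x X = T (dirDeriv f x X) := by
  have h := mfderiv_comp x T.mdifferentiableAt hf
  rw [T.mfderiv_eq] at h
  exact congrArg (fun L => L X) h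

variable [IsManifold (𝓡 m) ∞ M]

theorem SmoothFieldOn.sign_smul {r : ℝ} (hr : r = 1 ∨ r = -1)
    {V : ∀ x : M, TangentSpace (𝓡 m) x} {U : Set M} (hV : SmoothFieldOn V U) :
    SmoothFieldOn (fun x => r • V x) U := by
  rcases hr with rfl | rfl
  · simpa only [one_smul] using hV
  · simp only [neg_one_smul]
    exact ContMDiffOn.neg_section hV

theorem SmoothFieldOn.mdifferentiableAt {V : ∀ x : M, TangentSpace (𝓡 m) x} {U : Set M}
    (hV : SmoothFieldOn V U) (hU : IsOpen U) {x : M} (hx : x ∈ U) :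
    MDifferentiableAt (𝓡 m) (𝓡 m).tangent
      (fun x => (⟨x, V x⟩ : TangentBundle (𝓡 m) M)) x :=
  (hV.contMDiffAt (hU.mem_nhds hx)).mdifferentiableAt (by simp)

/-- Each of the six terms contains each field exactly once, so the constants factor out.
Differentiability of the fields enters through the Lie brackets. -/
theorem koszul_sign_smul (g : Metric m M) {a b c : ℝ} (ha : a = 1 ∨ a = -1) (hb : b = 1 ∨ b = -1)
    (hc : c = 1 ∨ c = -1) {X Y Z : ∀ y : M, TangentSpace (𝓡 m) y} {x : M}
    (hX : MDifferentiableAt (𝓡 m) (𝓡 m).tangent (fun y => (⟨y, X y⟩ : TangentBundle (𝓡 m) M)) x)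
    (hY : MDifferentiableAt (𝓡 m) (𝓡 m).tangent (fun y => (⟨y, Y y⟩ : TangentBundle (𝓡 m) M)) x)
    (hZ : MDifferentiableAt (𝓡 m) (𝓡 m).tangent (fun y => (⟨y, Z y⟩ : TangentBundle (𝓡 m) M)) x) :
    koszul g (fun y => a • X y) (fun y => b • Y y) (fun y => c • Z y) x =
      a * b * c * koszul g X Y Z x := by
  have hmul : ∀ {p q : ℝ}, p = 1 ∨ p = -1 → q = 1 ∨ q = -1 → p * q = 1 ∨ p * q = -1 := by
    rintro p q (rfl | rfl) (rfl | rfl) <;> norm_num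
  have hinner : ∀ (p q : ℝ) (y : M) (V W : TangentSpace (𝓡 m) y),
      g.inner y (p • V) (q • W) = p * q * g.inner y V W := fun p q y V W => by
    rw [map_smul, map_smul, smul_apply, smul_eq_mul, smul_eq_mul]
    ring
  have hD : ∀ {p q : ℝ}, p = 1 ∨ p = -1 → q = 1 ∨ q = -1 → ∀ (r : ℝ)
      (V W : ∀ y : M, TangentSpace (𝓡 m) y) (u : TangentSpace (𝓡 m) x),
      dirDeriv (fun y => g.inner y (p • V y) (q • W y)) x (r • u) =
        p * q * r * dirDeriv (fun y => g.inner y (V y) (W y)) x u := fun hp hq r V W u => by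
    simp only [hinner]
    rw [dirDeriv_smul, dirDeriv_sign_mul (hmul hp hq), smul_eq_mul]
    ring
  have hB : ∀ (p q r : ℝ) {V W : ∀ y : M, TangentSpace (𝓡 m) y}
      (_ : MDifferentiableAt (𝓡 m) (𝓡 m).tangent
        (fun y => (⟨y, V y⟩ : TangentBundle (𝓡 m) M)) x)
      (_ : MDifferentiableAt (𝓡 m) (𝓡 m).tangent
        (fun y => (⟨y, W y⟩ : TangentBundle (𝓡 m) M)) x) (u : TangentSpace (𝓡 m) x),
      g.inner x (VectorField.mlieBracket (𝓡 m) (fun y => p • V y) (fun y => q • W y) x) (r • u) =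
        p * q * r * g.inner x (VectorField.mlieBracket (𝓡 m) V W x) u := fun p q r V W hV hW u => by
    have e : VectorField.mlieBracket (𝓡 m) (fun y => p • V y) (fun y => q • W y) x =
        (p * q) • VectorField.mlieBracket (𝓡 m) V W x := by
      rw [mul_smul]
      exact (VectorField.mlieBracket_const_smul_left hV).trans
        (congrArg _ (VectorField.mlieBracket_const_smul_right hW))
    rw [e, hinner]
  unfold koszul
  rw [hD hb hc, hD hc ha, hD ha hb, hB a b c hX hY, hB b c a hY hZ, hB c a b hZ hX]
  ring

variable {g : Metric m M} {O : ManifoldOrientation m M}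

namespace SpinStructure

/-- The sign `r_k` occurs both in the `k`-th component of `X` and in the Koszul expression, so it
cancels and `r_i r_j` remains. -/
theorem connectionForm_flip (i₀ : Fin m) {O' : ManifoldOrientation m M}
    (h : ∀ x, O'.orient x = -O.orient x) (e : ∀ y : M, OrientedFrame g O y) {x : M}
    (he : ∀ i, MDifferentiableAt (𝓡 m) (𝓡 m).tangent
      (fun y => (⟨y, (e y).basis i⟩ : TangentBundle (𝓡 m) M)) x)
    (X : TangentSpace (𝓡 m) x) (i j : Fin m) :
    connectionForm (fun y => (e y).flip i₀ h) x X i j =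
      flipSign i₀ i * flipSign i₀ j * connectionForm e x X i j := by
  unfold connectionForm
  rw [Finset.mul_sum]
  refine Finset.sum_congr rfl fun k _ => ?_
  have hr : ((e x).flip i₀ h).basis.repr X k = (flipSign i₀ k : ℝ) * (e x).basis.repr X k := by
    change ((e x).basis.unitsSMul (flipSign i₀)).repr X k = _
    rw [Module.Basis.repr_unitsSMul, flipSign_inv]
    rfl
  simp only [OrientedFrame.flip_basis]
  rw [hr, koszul_sign_smul g (flipSign_eq_or i₀ k) (flipSign_eq_or i₀ i) (flipSign_eq_or i₀ j)
    (he k) (he i) (he j)]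
  linear_combination (flipSign i₀ i : ℝ) * flipSign i₀ j * (e x).basis.repr X k *
    koszul g (fun y => (e y).basis k) (fun y => (e y).basis i) (fun y => (e y).basis j) x *
    flipSign_mul_self i₀ k

variable {P : SpinStructure g O}

/-- The total space and its topology are unchanged, so only the signs of the frame fields matter. -/
theorem isSpinFrameOn_toFlip (i₀ : Fin m) {s : ∀ y : M, P.FiberAt y} {U : Set M} :
    IsSpinFrameOn (fun y => (s y).toFlip i₀) U ↔ IsSpinFrameOn s U := by
  refine and_congr Iff.rfl (and_congr Iff.rfl (forall_congr' fun i => ?_))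
  simp only [FiberAt.frame_toFlip, OrientedFrame.flip_basis]
  refine ⟨fun h => ?_, fun h => h.sign_smul (flipSign_eq_or i₀ i)⟩
  simpa only [smul_smul, flipSign_mul_self, one_smul] using h.sign_smul (flipSign_eq_or i₀ i)

/-! ### The isomorphism of spinor bundles -/

variable {S S' : Type*} [NormedAddCommGroup S] [InnerProductSpace ℂ S]
  [NormedAddCommGroup S'] [InnerProductSpace ℂ S']
  {σ' : SpinorModule m S'} {σ : SpinorModule m S} {i₀ : Fin m} {T : S' ≃ₗᵢ[ℂ] S}

/-- The isometric isomorphism of the fibres over `x` with `[p, s] ↦ [p, T s]`. -/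
def flipMap (P : SpinStructure g O) (i₀ : Fin m) (σ' : SpinorModule m S') (σ : SpinorModule m S)
    (T : S' ≃ₗᵢ[ℂ] S) (x : M) : (P.flip i₀).Spinor σ' x ≃ₗᵢ[ℂ] P.Spinor σ x :=
  (Spinor.coord σ' ((Spinor.basePoint P x).toFlip i₀)).trans
    (T.trans (Spinor.coord σ (Spinor.basePoint P x)).symm)

/-- This is independence of the auxiliary base point. The base point is `p · B` in `P`, but `p ·
r(B)` for the twisted action, and `T` turns `σ'(r(B))` into `σ(B)`. -/
theorem coord_flipMap (hT : SpinorModule.ReflectIntertwines i₀ σ' σ T.toLinearEquiv) {x : M}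
    (p : P.FiberAt x) (ψ : (P.flip i₀).Spinor σ' x) :
    Spinor.coord σ p (flipMap P i₀ σ' σ T x ψ) = T (Spinor.coord σ' (p.toFlip i₀) ψ) := by
  obtain ⟨B, hB⟩ := p.act_transitive (Spinor.basePoint P x)
  have e0 : Spinor.coord σ (Spinor.basePoint P x) (flipMap P i₀ σ' σ T x ψ) =
      T (Spinor.coord σ' ((Spinor.basePoint P x).toFlip i₀) ψ) :=
    LinearIsometryEquiv.apply_symm_apply _ _
  have e1 := Spinor.coordEquiv_act (σ := σ) p B (flipMap P i₀ σ' σ T x ψ)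
  have e2 := Spinor.coordEquiv_act (σ := σ') (p.toFlip i₀) (reflectSpin i₀ B) ψ
  rw [FiberAt.act_toFlip, reflectSpin_reflectSpin, ← hB, ← Spinor.coord_apply,
    ← Spinor.coord_apply] at e2
  rw [← hB, ← Spinor.coord_apply, ← Spinor.coord_apply] at e1
  rw [e1, e0, e2]
  have e3 := hT.act (reflectSpin i₀ B : Cl m)
    (Spinor.coord σ' ((Spinor.basePoint P x).toFlip i₀) ψ)
  rw [coe_reflectSpin, reflectCl_reflectCl] at e3
  exact e3.symm

theorem flipMap_mk (hT : SpinorModule.ReflectIntertwines i₀ σ' σ T.toLinearEquiv) {x : M}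
    (p : P.FiberAt x) (s : S') :
    flipMap P i₀ σ' σ T x (Spinor.mk σ' (p.toFlip i₀) s) = Spinor.mk σ p (T s) := by
  rw [← Spinor.mk_coord p (flipMap P i₀ σ' σ T x (Spinor.mk σ' (p.toFlip i₀) s)),
    coord_flipMap hT, Spinor.coord_mk]

/-- The components of `X` in the flipped frame are reflected, and `T` reflects them back. -/
theorem flipMap_cliffordMul (hT : SpinorModule.ReflectIntertwines i₀ σ' σ T.toLinearEquiv) {x : M}
    (X : TangentSpace (𝓡 m) x) (ψ : (P.flip i₀).Spinor σ' x) :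
    flipMap P i₀ σ' σ T x (Spinor.cliffordMul X ψ) =
      Spinor.cliffordMul X (flipMap P i₀ σ' σ T x ψ) := by
  let p := Spinor.basePoint P x
  rw [← Spinor.mk_coord (p.toFlip i₀) ψ, flipMap_mk hT]
  change flipMap P i₀ σ' σ T x (Spinor.mk σ' (p.toFlip i₀)
    (σ'.act (vec ((p.toFlip i₀).components X)) _)) =
      Spinor.mk σ p (σ.act (vec (p.components X)) (T _))
  rw [flipMap_mk hT, FiberAt.components_toFlip]
  congr 1
  refine (hT.act _ _).trans ?_
  rw [reflectCl_vec, reflect_reflect]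
  rfl

/-- Since `r` negates `ω`, `T` maps the `ε`-eigenspace of `ω` onto the `-ε`-eigenspace. -/
theorem flipMap_image_half (hT : SpinorModule.ReflectIntertwines i₀ σ' σ T.toLinearEquiv)
    (ε : ℤˣ) (x : M) :
    flipMap P i₀ σ' σ T x '' Spinor.half (P.flip i₀) σ' ε x = Spinor.half P σ (-ε) x := by
  have hvol : ∀ s, T (σ'.rep (complexVolume m) s) = -σ.rep (complexVolume m) (T s) := fun s => by
    have e := hT (complexVolume m) s
    rw [reflectCx_complexVolume, map_neg] at e
    exact e
  have heig : ∀ s, σ'.rep (complexVolume m) s = ((ε : ℤ) : ℂ) • s ↔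
      σ.rep (complexVolume m) (T s) = (((-ε : ℤˣ) : ℤ) : ℂ) • T s := fun s => by
    rw [← T.injective.eq_iff, hvol, map_smul, neg_eq_iff_eq_neg]
    simp
  ext ψ
  constructor
  · rintro ⟨_, ⟨p, s, hs, rfl⟩, rfl⟩
    exact ⟨p.ofFlip, T s, (heig s).1 hs, flipMap_mk hT p.ofFlip s⟩
  · rintro ⟨p, t, ht, rfl⟩
    obtain ⟨s, rfl⟩ := T.surjective t
    exact ⟨_, ⟨p.toFlip i₀, s, (heig s).2 ht, rfl⟩, flipMap_mk hT p s⟩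

/-- In corresponding local spin frames the coordinate functions are `φ` and `T φ`, with `T` a
constant invertible linear map. -/
theorem smoothNear_flipMap (hT : SpinorModule.ReflectIntertwines i₀ σ' σ T.toLinearEquiv)
    (ψ : ∀ x, (P.flip i₀).Spinor σ' x) (x : M) :
    SmoothNear ψ x ↔ SmoothNear (fun y => flipMap P i₀ σ' σ T y (ψ y)) x := by
  have key : ∀ (s : ∀ y : M, P.FiberAt y) (U : Set M),
      ContMDiffOn (𝓡 m) 𝓘(ℝ, S') ∞ (fun y => Spinor.coord σ' ((s y).toFlip i₀) (ψ y)) U ↔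
      ContMDiffOn (𝓡 m) 𝓘(ℝ, S) ∞
        (fun y => Spinor.coord σ (s y) (flipMap P i₀ σ' σ T y (ψ y))) U := fun s U => by
    simp only [coord_flipMap hT]
    constructor
    · intro h
      exact ((T : S' →L[ℂ] S).restrictScalars ℝ).contMDiff.comp_contMDiffOn h
    · intro h
      have := ((T.symm : S →L[ℂ] S').restrictScalars ℝ).contMDiff.comp_contMDiffOn h
      exact this.congr fun y _ => (T.symm_apply_apply _).symm
  constructor
  · rintro ⟨s, U, hx, hs, h⟩
    exact ⟨fun y => (s y).ofFlip, U, hx, (isSpinFrameOn_toFlip i₀).1 hs, (key _ U).1 h⟩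
  · rintro ⟨s, U, hx, hs, h⟩
    exact ⟨fun y => (s y).toFlip i₀, U, hx, (isSpinFrameOn_toFlip i₀).2 hs, (key s U).2 h⟩

/-- In corresponding frames, `T` commutes with the derivative. In the connection term the factor
`r_i r_j` appears once from `ω_ij` and once from `E_i E_j`. -/
theorem hasCovDerivAt_flipMap (hT : SpinorModule.ReflectIntertwines i₀ σ' σ T.toLinearEquiv)
    (ψ : ∀ x, (P.flip i₀).Spinor σ' x) (x : M) (X : TangentSpace (𝓡 m) x)
    (η : (P.flip i₀).Spinor σ' x) :
    HasCovDerivAt ψ x X η ↔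
      HasCovDerivAt (fun y => flipMap P i₀ σ' σ T y (ψ y)) x X (flipMap P i₀ σ' σ T x η) := by
  let T₁ : S' →L[ℝ] S := (T : S' →L[ℂ] S).restrictScalars ℝ
  have hdiff : ∀ (s : ∀ y : M, P.FiberAt y),
      MDifferentiableAt (𝓡 m) 𝓘(ℝ, S') (fun y => Spinor.coord σ' ((s y).toFlip i₀) (ψ y)) x ↔
      MDifferentiableAt (𝓡 m) 𝓘(ℝ, S)
        (fun y => Spinor.coord σ (s y) (flipMap P i₀ σ' σ T y (ψ y))) x := fun s => by
    simp only [coord_flipMap hT]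
    constructor
    · intro h
      exact T₁.mdifferentiableAt.comp x h
    · intro h
      have := ((T.symm : S →L[ℂ] S').restrictScalars ℝ).mdifferentiableAt.comp x h
      exact this.congr_of_eventuallyEq
        (Filter.Eventually.of_forall fun y => (T.symm_apply_apply _).symm)
  have hval : ∀ (s : ∀ y : M, P.FiberAt y) (U : Set M), x ∈ U → IsSpinFrameOn s U →
      MDifferentiableAt (𝓡 m) 𝓘(ℝ, S') (fun y => Spinor.coord σ' ((s y).toFlip i₀) (ψ y)) x →
      T (dirDeriv (fun y => Spinor.coord σ' ((s y).toFlip i₀) (ψ y)) x X +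
        (1 / 4 : ℝ) • ∑ i, ∑ j, connectionForm (fun y => ((s y).toFlip i₀).frame) x X i j •
          σ'.act (vec (E i) * vec (E j)) (Spinor.coord σ' ((s x).toFlip i₀) (ψ x))) =
      dirDeriv (fun y => Spinor.coord σ (s y) (flipMap P i₀ σ' σ T y (ψ y))) x X +
        (1 / 4 : ℝ) • ∑ i, ∑ j, connectionForm (fun y => (s y).frame) x X i j •
          σ.act (vec (E i) * vec (E j))
            (Spinor.coord σ (s x) (flipMap P i₀ σ' σ T x (ψ x))) := fun s U hx hs hd => by
    have he : ∀ i, MDifferentiableAt (𝓡 m) (𝓡 m).tangent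
        (fun y => (⟨y, (s y).frame.basis i⟩ : TangentBundle (𝓡 m) M)) x :=
      fun i => (hs.2.2 i).mdifferentiableAt hs.1 hx
    -- `T` is viewed as real linear so that the real coefficients can be pulled out.
    change T₁ _ = _
    simp only [coord_flipMap hT, FiberAt.frame_toFlip, map_add, map_smul, map_sum]
    congr 1
    · exact (dirDeriv_clm_comp T₁ hd X).symm
    · congr 1
      refine Finset.sum_congr rfl fun i _ => Finset.sum_congr rfl fun j _ => ?_
      rw [connectionForm_flip i₀ O.neg_orient _ he]
      have e : T₁ (σ'.act (vec (E i) * vec (E j)) (Spinor.coord σ' ((s x).toFlip i₀) (ψ x))) =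
          σ.act (reflectCl i₀ (vec (E i) * vec (E j)))
            (T (Spinor.coord σ' ((s x).toFlip i₀) (ψ x))) := hT.act _ _
      rw [e, map_mul, reflectCl_vec, reflectCl_vec, reflect_E, reflect_E, vec_smul, vec_smul,
        smul_mul_smul_comm, SpinorModule.act_smul, LinearMap.smul_apply, smul_smul]
      congr 1
      linear_combination connectionForm (fun y => (s y).frame) x X i j *
        ((flipSign i₀ j : ℝ) * (flipSign i₀ j : ℝ) * flipSign_mul_self i₀ i +
          flipSign_mul_self i₀ j)
  constructor
  · rintro ⟨s, U, hx, hs, hd, rfl⟩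
    have hs' := (isSpinFrameOn_toFlip (s := fun y => (s y).ofFlip) i₀).1 hs
    refine ⟨fun y => (s y).ofFlip, U, hx, hs', (hdiff _).1 hd, ?_⟩
    rw [← hval _ U hx hs' hd]
    exact flipMap_mk hT (s x).ofFlip _
  · rintro ⟨s, U, hx, hs, hd, hη⟩
    have hd' := (hdiff s).2 hd
    refine ⟨fun y => (s y).toFlip i₀, U, hx, (isSpinFrameOn_toFlip i₀).2 hs, hd', ?_⟩
    -- Here `η` is known only through its image, so the equation is checked after applying the
    -- isomorphism.
    apply (flipMap P i₀ σ' σ T x).injective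
    rw [hη, ← hval s U hx hs hd']
    exact (flipMap_mk hT (s x) _).symm

/-- The isomorphism of spinor bundles `[p, s] ↦ [p, T s]`. -/
def flipIso (P : SpinStructure g O)
    (hT : SpinorModule.ReflectIntertwines i₀ σ' σ T.toLinearEquiv) :
    SpinorIso (P.flip i₀) σ' P σ where
  map := flipMap P i₀ σ' σ T
  smooth := smoothNear_flipMap hT
  parallel := hasCovDerivAt_flipMap hT
  clifford _ X ψ := flipMap_cliffordMul hT X ψ

end SpinStructure
end Manifold
end SpinOr
end

theorem propositionC1 {m : ℕ} (hm : 0 < m) {M : Type v} [TopologicalSpace M]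
    [ChartedSpace (EuclideanSpace ℝ (Fin m)) M] [IsManifold (𝓡 m) ∞ M]
    (g : Metric m M) (O : ManifoldOrientation m M) (P : SpinStructure.{v, u} g O) :
    ∃ P' : SpinStructure.{v, u} g (-O),
      (Even m →
        ∀ (S : Type w) [NormedAddCommGroup S] [InnerProductSpace ℂ S] [FiniteDimensional ℂ S]
          (σ : SpinorModule m S),
          ∃ Ψ : SpinorIso P' σ P σ,
            (∀ x : M, Ψ.map x '' Spinor.half P' σ 1 x = Spinor.half P σ (-1) x) ∧
            (∀ x : M, Ψ.map x '' Spinor.half P' σ (-1) x = Spinor.half P σ 1 x)) ∧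
      (Odd m →
        ∀ (S : Type w) [NormedAddCommGroup S] [InnerProductSpace ℂ S] [FiniteDimensional ℂ S]
          (S' : Type w') [NormedAddCommGroup S'] [InnerProductSpace ℂ S']
          [FiniteDimensional ℂ S']
          (σ : SpinorModule m S) (σ' : SpinorModule m S'),
          σ.VolumeIsOne → σ'.VolumeIsNegOne →
          Nonempty (SpinorIso P' σ P σ') ∧ Nonempty (SpinorIso P' σ' P σ)) := by
  refine ⟨P.flip ⟨0, hm⟩, fun heven S _ _ _ σ => ?_, fun _ S _ _ _ S' _ _ _ σ σ' hσ hσ' => ?_⟩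
  · obtain ⟨T, hT⟩ := σ.exists_reflectIntertwines_of_even heven ⟨0, hm⟩
    refine ⟨flipIso P hT, fun x => flipMap_image_half hT 1 x, fun x => ?_⟩
    exact (flipMap_image_half hT (-1) x).trans (by rw [neg_neg])
  · rw [SpinorModule.VolumeIsOne] at hσ
    rw [SpinorModule.VolumeIsNegOne] at hσ'
    -- The scalar `c` is the value of `ω` on the source module: `1` for `Σ → Σ^#`, then `-1` for
    -- `Σ^# → Σ`.
    obtain ⟨T, hT⟩ := SpinorModule.exists_reflectIntertwines_of_scalar ⟨0, hm⟩ σ σ'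
      (c := 1) one_ne_zero (by rw [hσ, one_smul]) (by rw [hσ', one_smul])
    obtain ⟨T', hT'⟩ := SpinorModule.exists_reflectIntertwines_of_scalar ⟨0, hm⟩ σ' σ
      (c := -1) (neg_ne_zero.2 one_ne_zero) (by rw [hσ', neg_one_smul])
      (by rw [hσ, neg_one_smul, neg_neg])
    exact ⟨⟨flipIso P hT⟩, ⟨flipIso P hT'⟩⟩
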